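/- Write $S^1=\mathbb R/\mathbb Z$ and $\mathbb T^2=\mathbb R^2/\mathbb Z^2$, let $(\phi,I)$ be the coordinates of $\mathbb R^2$, and let $p:\mathbb R^2\to\mathbb T^2$ be the quotient map. Let $TQ$ be the set of $C^1$ diffeomorphisms $T=(T_\phi,T_I):\mathbb R^2\to\mathbb R^2$ that are lifts of $C^1$ diffeomorphisms of the cylinder $S^1\times\mathbb R$, satisfy $\partial_I T_\phi>0$, satisfy $T_\phi(\phi,I)\to\pm\infty$ and $T_I(\phi,I)\to\pm\infty$ as $I\to\pm\infty$ for every $\phi$, and satisfy $$T(\phi+1,I)=T(\phi,I)+(1,0),\qquad T(\phi,I+1)=T(\phi,I)+(1,1).$$ Such a $T$ induces a map $\widehat T$ of $S^1\times\mathbb R$ and a map $\overline T$ of $\mathbb T^2$. Let $\mu$ be a Borel measure on $S^1\times\mathbb R$ that is finite on compact sets, positive on non-empty open sets and absolutely continuous with respect to Lebesgue measure. The map $\widehat T$ is called $\mu$-exact if $\mu$ is $\widehat T$-invariant and $\mu(\widehat T(A)\setminus A)=\mu(A\setminus\widehat T(A))$ for every open set $A\subset S^1\times\mathbb R$ that is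 homeomorphic to $S^1\times\mathbb R$ and has compact boundary. A rotational invariant circle of $T$ is a homotopically non-trivial simple closed curve $C\subset S^1\times\mathbb R$ with $\widehat T(C)=C$. A periodic orbit $O\subset\mathbb T^2$ of $\overline T$ has vertical rotation number $\omega\in\mathbb R$ if for every $z\in p^{-1}(O)$ the limit $\lim_{n\to\infty}\frac{T^n(z)-z}{n}$ exists in $[-\infty,+\infty]^2$ and equals $(+\infty,\omega)$ or $(-\infty,\omega)$. **Theorem.** Let $T\in TQ$ and let $\mu$ be a measure as above such that $\widehat T$ is $\mu$-exact. Then for every integer $k\neq 0$ the following are equivalent: 1. there is an integer $N>0$ such that $\overline T$ has a periodic orbit with vertical rotation number $k/N$; 2. $T$ has no rotational invariant circle. -/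

import Mathlib

open MeasureTheory Filter Topology

noncomputable section

/-- The cylinder `S¹ × ℝ` with `S¹ = ℝ / ℤ`; coordinates `(φ, I)`. -/
abbrev Cylinder : Type := UnitAddCircle × ℝ

/-- The torus `ℝ² / ℤ²`. -/
abbrev Torus : Type := UnitAddCircle × UnitAddCircle

/-- The covering map from the plane to the cylinder. -/
def cylProj (z : ℝ × ℝ) : Cylinder := ((z.1 : UnitAddCircle), z.2)

/-- The covering map from the plane to the torus. -/
def torusProj (z : ℝ × ℝ) : Torus := ((z.1 : UnitAddCircle), (z.2 : UnitAddCircle))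

/-- The representative in `[0, 1)` of a point of the circle. -/
def circleRep (x : UnitAddCircle) : ℝ := (AddCircle.equivIco (1 : ℝ) 0 x : ℝ)

/-- The map of the cylinder induced by a map of the plane, computed on representatives
(see `inducedCylMap_cylProj`). -/
def inducedCylMap (f : ℝ × ℝ → ℝ × ℝ) (x : Cylinder) : Cylinder :=
  cylProj (f (circleRep x.1, x.2))

/-- The map of the torus induced by a map of the plane, computed on representatives
(see `inducedTorusMap_torusProj`). -/
def inducedTorusMap (f : ℝ × ℝ → ℝ × ℝ) (x : Torus) : Torus :=
  torusProj (f (circleRep x.1, circleRep x.2))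

/-- `C¹` diffeomorphisms of the plane. -/
def IsC1Diffeo (f : ℝ × ℝ → ℝ × ℝ) : Prop :=
  ContDiff ℝ 1 f ∧
    ∃ g : ℝ × ℝ → ℝ × ℝ, ContDiff ℝ 1 g ∧ Function.LeftInverse g f ∧ Function.RightInverse g f

/-- The set `D_r¹(ℝ²)` of lifts of `C¹` twist diffeomorphisms of the cylinder.
As `cylProj` is a local diffeomorphism and `f` is a `C¹` diffeomorphism, a homeomorphism of the
cylinder that is lifted by `f` is the same thing as a `C¹` diffeomorphism lifted by `f`. -/
structure IsTwistLift (f : ℝ × ℝ → ℝ × ℝ) : Prop where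
  diffeo : IsC1Diffeo f
  snd_atTop : ∀ φ : ℝ, Tendsto (fun I : ℝ => (f (φ, I)).2) atTop atTop
  snd_atBot : ∀ φ : ℝ, Tendsto (fun I : ℝ => (f (φ, I)).2) atBot atBot
  twist : ∀ φ I : ℝ, 0 < deriv (fun J : ℝ => (f (φ, J)).1) I
  fst_atTop : ∀ φ : ℝ, Tendsto (fun I : ℝ => (f (φ, I)).1) atTop atTop
  fst_atBot : ∀ φ : ℝ, Tendsto (fun I : ℝ => (f (φ, I)).1) atBot atBot
  lift : ∃ F : Cylinder ≃ₜ Cylinder, ∀ z, F (cylProj z) = cylProj (f z)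

/-- The set `TQ`: twist lifts that induce a map of the torus homotopic to
`(φ, I) ↦ (φ + I, I)`. -/
structure IsTQ (T : ℝ × ℝ → ℝ × ℝ) : Prop extends IsTwistLift T where
  snd_add_one_left : ∀ φ I : ℝ, (T (φ + 1, I)).2 = (T (φ, I)).2
  snd_add_one_right : ∀ φ I : ℝ, (T (φ, I + 1)).2 = (T (φ, I)).2 + 1
  fst_add_one_left : ∀ φ I : ℝ, (T (φ + 1, I)).1 = (T (φ, I)).1 + 1
  fst_add_one_right : ∀ φ I : ℝ, (T (φ, I + 1)).1 = (T (φ, I)).1 + 1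

/-- `F` is `μ`-exact: `μ` is `F`-invariant and the net flux of `F` through every open set
homeomorphic to the cylinder, with compact boundary, vanishes. -/
structure IsMuExact (μ : Measure Cylinder) (F : Cylinder → Cylinder) : Prop where
  invariant : MeasurePreserving F μ μ
  flux : ∀ A : Set Cylinder, IsOpen A → Nonempty (A ≃ₜ Cylinder) → IsCompact (frontier A) →
    μ (F '' A \ A) = μ (A \ F '' A)

/-- `C` is a rotational invariant circle for `T`: a homotopically non-trivial simple closed curve
on the cylinder that is mapped onto itself by the induced map. -/
def IsRotationalInvariantCircle (T : ℝ × ℝ → ℝ × ℝ) (C : Set Cylinder) : Prop :=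
  (∃ γ : C(UnitAddCircle, Cylinder),
    Function.Injective γ ∧ ¬ γ.Nullhomotopic ∧ Set.range γ = C) ∧
  inducedCylMap T '' C = C

/-- `O` is a periodic orbit of `F`. -/
def IsPeriodicOrbit (F : Torus → Torus) (O : Set Torus) : Prop :=
  ∃ x ∈ Function.periodicPts F, O = Set.range fun n : ℕ => F^[n] x

/-- The point `z` of the plane has rotation vector `v`, with values in the extended reals. -/
def HasRotationVector (T : ℝ × ℝ → ℝ × ℝ) (z : ℝ × ℝ) (v : EReal × EReal) : Prop :=
  Tendsto (fun n : ℕ =>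
      (((((T^[n] z).1 - z.1) / n : ℝ) : EReal), ((((T^[n] z).2 - z.2) / n : ℝ) : EReal)))
    atTop (𝓝 v)

/-- The set `O` (a periodic orbit, say) of points of the torus has vertical rotation number `ω`:
all lifts of all of its points have rotation vector `(+∞, ω)` or `(-∞, ω)`. -/
def HasVerticalRotationNumber (T : ℝ × ℝ → ℝ × ℝ) (O : Set Torus) (ω : ℝ) : Prop :=
  ∀ z : ℝ × ℝ, torusProj z ∈ O →
    HasRotationVector T z (⊤, (ω : EReal)) ∨ HasRotationVector T z (⊥, (ω : EReal))

theorem coe_circleRep (x : UnitAddCircle) : ((circleRep x : ℝ) : UnitAddCircle) = x :=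
  AddCircle.coe_equivIco

theorem exists_int_add_eq {a b : ℝ} (h : (a : UnitAddCircle) = b) : ∃ m : ℤ, b = a + m := by
  have h0 : ((b - a : ℝ) : UnitAddCircle) = 0 := by
    rw [AddCircle.coe_sub, h, sub_self]
  obtain ⟨m, hm⟩ := (AddCircle.coe_eq_zero_iff (1 : ℝ)).1 h0
  refine ⟨m, ?_⟩
  simp only [zsmul_eq_mul, mul_one] at hm
  linarith

theorem map_add_int_of_map_add_one {g : ℝ → UnitAddCircle} (h : ∀ x, g (x + 1) = g x) (m : ℤ)
    (x : ℝ) : g (x + m) = g x := by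
  have hp : Function.Periodic g 1 := h
  simpa using hp.int_mul m x

/-- The map `inducedCylMap f` is the one that `f` lifts. -/
theorem inducedCylMap_cylProj {f : ℝ × ℝ → ℝ × ℝ} (hf : IsTwistLift f) (z : ℝ × ℝ) :
    inducedCylMap f (cylProj z) = cylProj (f z) := by
  obtain ⟨F, hF⟩ := hf.lift
  have h : cylProj (circleRep (cylProj z).1, (cylProj z).2) = cylProj z := by
    simp [cylProj, coe_circleRep]
  rw [inducedCylMap, ← hF, h, hF]

/-- The map `inducedTorusMap T` is the one that `T` lifts. -/
theorem inducedTorusMap_torusProj {T : ℝ × ℝ → ℝ × ℝ} (hT : IsTQ T) (z : ℝ × ℝ) :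
    inducedTorusMap T (torusProj z) = torusProj (T z) := by
  have hφ : ∀ (φ I : ℝ) (m : ℤ), torusProj (T (φ + m, I)) = torusProj (T (φ, I)) := by
    intro φ I m
    refine Prod.ext ?_ ?_
    · exact map_add_int_of_map_add_one (g := fun x => ((T (x, I)).1 : UnitAddCircle))
        (fun x => by simp [hT.fst_add_one_left]) m φ
    · exact map_add_int_of_map_add_one (g := fun x => ((T (x, I)).2 : UnitAddCircle))
        (fun x => by simp [hT.snd_add_one_left]) m φ
  have hI : ∀ (φ I : ℝ) (m : ℤ), torusProj (T (φ, I + m)) = torusProj (T (φ, I)) := by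
    intro φ I m
    refine Prod.ext ?_ ?_
    · exact map_add_int_of_map_add_one (g := fun x => ((T (φ, x)).1 : UnitAddCircle))
        (fun x => by simp [hT.fst_add_one_right]) m I
    · exact map_add_int_of_map_add_one (g := fun x => ((T (φ, x)).2 : UnitAddCircle))
        (fun x => by simp [hT.snd_add_one_right]) m I
  obtain ⟨φ, I⟩ := z
  obtain ⟨m, hm⟩ := exists_int_add_eq (coe_circleRep (φ : UnitAddCircle))
  obtain ⟨l, hl⟩ := exists_int_add_eq (coe_circleRep (I : UnitAddCircle))
  have h1 := hφ (circleRep φ) I m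
  have h2 := hI (circleRep φ) (circleRep I) l
  rw [← hm] at h1
  rw [← hl] at h2
  rw [h1, h2]
  rfl

end

noncomputable section

/-! ### Doubly periodic functions -/

/-! The twist lets an orbit be described by its positions: `x 0, x 1, …` comes from an orbit exactly
when `momIn T (x j) (x (j+1)) = momOut T (x (j+1)) (x (j+2))`. Since `momOut` increases in its
second argument and `momIn` decreases in its first, the defect of this equation is nondecreasing in
the neighbours of `x (j+1)`. It is a discrete elliptic equation, so an ordered pair of a subsolution
and a supersolution encloses a true orbit (`exists_zero_between`, `exists_orbit_between`).

No circle implies a climbing orbit. Exactness enters only through `IsDriftFree`. Let `U` be the set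
reached from the lower half-plane by applying `T` and moving down at will. If `U` is bounded above,
it is mapped into itself, drift-freeness makes it invariant, and the twist in both time directions
makes its upper boundary the graph of a continuous function, as in Birkhoff's theorem
(`exists_invariant_graph`). That graph projects to an invariant circle. If `U` is unbounded, there
are pseudo-orbits that jump only downwards and still climb as far as desired. Their positions form
supersolutions. Drift-freeness also yields an orbit of the same length and horizontal displacement
that does not climb (`exists_iterate_snd_le`), a subsolution. Between the two lies an orbit with
`T^[N] z = z + (s, k)`. It closes up on the torus, its height grows like `k n / N` and its abscissa
quadratically in `n`. This treats `k ≥ 0`; conjugation by `-id` gives the rest.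

A climbing orbit excludes a circle. An essential closed curve meets every path from far below it to
far above it (`exists_cylProj_mem_range`). An orbit with nonzero vertical speed, shifted vertically
by an integer, would carry a vertical ray that misses an invariant circle to a path that has to meet
it. -/

theorem exists_int_add_mem_Ico (x : ℝ) : ∃ m : ℤ, x + m ∈ Set.Ico (0 : ℝ) 1 :=
  ⟨-⌊x⌋, by
    push_cast
    constructor
    · linarith [Int.floor_le x]
    · linarith [Int.lt_floor_add_one x]⟩

/-- Functions on the plane that are `1`-periodic in both variables. -/
structure IsDoublyPeriodic (g : ℝ × ℝ → ℝ) : Prop where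
  left : ∀ x y, g (x + 1, y) = g (x, y)
  right : ∀ x y, g (x, y + 1) = g (x, y)

namespace IsDoublyPeriodic

variable {g : ℝ × ℝ → ℝ}

theorem add_int (hg : IsDoublyPeriodic g) (x y : ℝ) (m n : ℤ) : g (x + m, y + n) = g (x, y) := by
  have h1 : Function.Periodic (fun x => g (x, y + n)) 1 := fun x => hg.left x _
  have h2 : Function.Periodic (fun y => g (x, y)) 1 := fun y => hg.right x y
  have e1 := h1.int_mul m x
  have e2 := h2.int_mul n y
  simp only [mul_one] at e1 e2
  rw [e1, e2]

theorem exists_abs_le (hg : IsDoublyPeriodic g) (hc : Continuous g) : ∃ C, ∀ z, |g z| ≤ C := by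
  obtain ⟨C, hC⟩ := ((isCompact_Icc (a := (0 : ℝ)) (b := 1)).prod
    (isCompact_Icc (a := (0 : ℝ)) (b := 1))).exists_bound_of_continuousOn hc.continuousOn
  refine ⟨C, fun ⟨x, y⟩ => ?_⟩
  obtain ⟨m, hm⟩ := exists_int_add_mem_Ico x
  obtain ⟨n, hn⟩ := exists_int_add_mem_Ico y
  rw [← hg.add_int x y m n]
  exact hC _ ⟨⟨hm.1, hm.2.le⟩, hn.1, hn.2.le⟩

theorem uniformContinuous (hg : IsDoublyPeriodic g) (hc : Continuous g) : UniformContinuous g := by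
  have hK := ((isCompact_Icc (a := (-1 : ℝ)) (b := 2)).prod
    (isCompact_Icc (a := (-1 : ℝ)) (b := 2))).uniformContinuousOn_of_continuous hc.continuousOn
  rw [Metric.uniformContinuousOn_iff] at hK
  rw [Metric.uniformContinuous_iff]
  intro ε hε
  obtain ⟨δ, hδ, h⟩ := hK ε hε
  refine ⟨min δ 1, by positivity, ?_⟩
  rintro ⟨x, y⟩ ⟨x', y'⟩ hd
  obtain ⟨m, hm⟩ := exists_int_add_mem_Ico x
  obtain ⟨n, hn⟩ := exists_int_add_mem_Ico y
  rw [← hg.add_int x y m n, ← hg.add_int x' y' m n]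
  rw [Prod.dist_eq, max_lt_iff, Real.dist_eq, Real.dist_eq] at hd
  obtain ⟨h1, h2⟩ := hd
  have h1' := abs_lt.1 (lt_of_lt_of_le h1 (min_le_right _ _))
  have h2' := abs_lt.1 (lt_of_lt_of_le h2 (min_le_right _ _))
  dsimp only at h1' h2'
  obtain ⟨hm1, hm2⟩ := hm
  obtain ⟨hn1, hn2⟩ := hn
  refine h _ ⟨⟨by linarith, by linarith⟩, by dsimp only; linarith, by dsimp only; linarith⟩ _
    ⟨⟨by dsimp only; linarith, by dsimp only; linarith⟩, by dsimp only; linarith,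
      by dsimp only; linarith⟩ ?_
  rw [Prod.dist_eq, max_lt_iff, Real.dist_eq, Real.dist_eq]
  dsimp only
  rw [add_sub_add_right_eq_sub, add_sub_add_right_eq_sub]
  exact ⟨lt_of_lt_of_le h1 (min_le_left _ _), lt_of_lt_of_le h2 (min_le_left _ _)⟩

end IsDoublyPeriodic

/-! ### Twist homeomorphisms of the plane -/

/-- A homeomorphism `T` of the plane with inverse `S`, equivariant as the elements of `TQ`, such
that `T` twists verticals to the right and `S` twists them to the left. -/
structure IsTwistPair (T S : ℝ × ℝ → ℝ × ℝ) : Prop where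
  cont : Continuous T
  cont_inv : Continuous S
  left_inv : Function.LeftInverse S T
  right_inv : Function.RightInverse S T
  add_left : ∀ z, T (z + (1, 0)) = T z + (1, 0)
  add_right : ∀ z, T (z + (0, 1)) = T z + (1, 1)
  mono : ∀ x, StrictMono fun I => (T (x, I)).1
  anti : ∀ x, StrictAnti fun I => (S (x, I)).1

/-- The twist of `T` makes each `fun I => (S (x, I)).1` injective, hence strictly monotone; the
relation `S (w + (0, 1)) = S w + (-1, 1)` decides the direction. Everything about orbits and graphs
below is purely topological. -/
theorem IsTQ.exists_isTwistPair {T : ℝ × ℝ → ℝ × ℝ} (hT : IsTQ T) : ∃ S, IsTwistPair T S := by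
  obtain ⟨hc, S, hS, hl, hr⟩ := hT.diffeo
  have hmono : ∀ x, StrictMono fun I => (T (x, I)).1 := fun x =>
    strictMono_of_deriv_pos fun I => hT.twist x I
  have h1 : ∀ z, T (z + (1, 0)) = T z + (1, 0) := by
    rintro ⟨x, I⟩
    ext <;> simp [hT.fst_add_one_left, hT.snd_add_one_left]
  have h2 : ∀ z, T (z + (0, 1)) = T z + (1, 1) := by
    rintro ⟨x, I⟩
    ext <;> simp [hT.fst_add_one_right, hT.snd_add_one_right]
  have h3 : ∀ w, S (w + (0, 1)) = S w + (-1, 1) := by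
    intro w
    apply hl.injective
    rw [hr]
    have e : S w + (-1, 1) + (1, 0) = S w + (0, 1) := by ext <;> simp
    have := h1 (S w + (-1, 1))
    rw [e, h2, hr] at this
    have e' : w + ((1 : ℝ), (1 : ℝ)) = w + (0, 1) + (1, 0) := by ext <;> simp
    rw [e'] at this
    exact add_right_cancel this
  refine ⟨S, hc.continuous, hS.continuous, hl, hr, h1, h2, hmono, fun x => ?_⟩
  have hcont : Continuous fun I => (S (x, I)).1 := by
    have := hS.continuous
    fun_prop
  have hinj : Function.Injective fun I => (S (x, I)).1 := by
    intro I J h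
    have e : (S (x, I)).2 = (S (x, J)).2 := by
      apply (hmono (S (x, I)).1).injective
      dsimp only at h ⊢
      conv_rhs => rw [h]
      simp [hr _]
    have : S (x, I) = S (x, J) := Prod.ext h e
    simpa using hr.injective this
  rcases hcont.strictMono_of_inj hinj with h | h
  · have := h (zero_lt_one' ℝ)
    have e := h3 (x, 0)
    simp only [Prod.mk_add_mk, add_zero, zero_add] at e
    dsimp only at this
    rw [e] at this
    simp at this
    linarith
  · exact h

namespace IsTwistPair

variable {T S : ℝ × ℝ → ℝ × ℝ}

theorem add_int_left (h : IsTwistPair T S) (z : ℝ × ℝ) (m : ℤ) :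
    T (z + ((m : ℝ), 0)) = T z + ((m : ℝ), 0) := by
  have hp : Function.Periodic (fun x : ℝ => T (z + (x, 0)) - (x, 0)) 1 := fun x => by
    have := h.add_left (z + (x, 0))
    rw [add_assoc] at this
    simp only [Prod.mk_add_mk, add_zero] at this
    dsimp only
    rw [this]
    ext <;> simp
  have e := hp.int_mul m 0
  simp only [mul_one, zero_add] at e
  rw [sub_eq_iff_eq_add] at e
  rw [e]
  ext <;> simp [← Prod.zero_eq_mk]

theorem add_int_right (h : IsTwistPair T S) (z : ℝ × ℝ) (m : ℤ) :
    T (z + (0, (m : ℝ))) = T z + ((m : ℝ), (m : ℝ)) := by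
  have hp : Function.Periodic (fun x : ℝ => T (z + (0, x)) - (x, x)) 1 := fun x => by
    have := h.add_right (z + (0, x))
    rw [add_assoc] at this
    simp only [Prod.mk_add_mk, add_zero] at this
    dsimp only
    rw [this]
    ext <;> simp
  have e := hp.int_mul m 0
  simp only [mul_one, zero_add] at e
  rw [sub_eq_iff_eq_add] at e
  rw [e]
  ext <;> simp [← Prod.zero_eq_mk]

theorem add_int (h : IsTwistPair T S) (z : ℝ × ℝ) (m l : ℤ) :
    T (z + ((m : ℝ), (l : ℝ))) = T z + ((m : ℝ) + l, (l : ℝ)) := by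
  have e : z + ((m : ℝ), (l : ℝ)) = z + ((m : ℝ), 0) + (0, (l : ℝ)) := by ext <;> simp
  rw [e, h.add_int_right, h.add_int_left]
  ext <;> simp [add_assoc]

theorem iterate_add_int (h : IsTwistPair T S) (n : ℕ) (z : ℝ × ℝ) (m l : ℤ) :
    T^[n] (z + ((m : ℝ), (l : ℝ))) = T^[n] z + ((m : ℝ) + n * l, (l : ℝ)) := by
  induction n with
  | zero => simp
  | succ n ih =>
    rw [Function.iterate_succ_apply', ih, Function.iterate_succ_apply']
    have := h.add_int (T^[n] z) (m + n * l) l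
    push_cast at this
    rw [this]
    ext <;> simp
    ring

theorem continuous_iterate (h : IsTwistPair T S) (n : ℕ) : Continuous T^[n] := h.cont.iterate n

theorem iterate_left_inv (h : IsTwistPair T S) (n : ℕ) : Function.LeftInverse S^[n] T^[n] :=
  h.left_inv.iterate n

theorem iterate_right_inv (h : IsTwistPair T S) (n : ℕ) : Function.RightInverse S^[n] T^[n] :=
  h.right_inv.iterate n

theorem exists_abs_iterate_snd_sub_le (h : IsTwistPair T S) (n : ℕ) :
    ∃ C, ∀ z, |(T^[n] z).2 - z.2| ≤ C := by
  refine IsDoublyPeriodic.exists_abs_le (g := fun z => (T^[n] z).2 - z.2) ⟨?_, ?_⟩ ?_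
  · intro x y
    have := h.iterate_add_int n (x, y) 1 0
    simp at this
    simp [this]
  · intro x y
    have := h.iterate_add_int n (x, y) 0 1
    simp at this
    simp [this]
  · have := h.continuous_iterate n
    fun_prop

/-- `T^[n]` is the shear of slope `n` up to a doubly periodic error. Hence for `n > 0` each vertical
contains points of every horizontal displacement, and their heights are bounded. -/
theorem exists_abs_iterate_fst_sub_le (h : IsTwistPair T S) (n : ℕ) :
    ∃ C, ∀ z, |(T^[n] z).1 - z.1 - n * z.2| ≤ C := by
  refine IsDoublyPeriodic.exists_abs_le (g := fun z => (T^[n] z).1 - z.1 - n * z.2) ⟨?_, ?_⟩ ?_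
  · intro x y
    have := h.iterate_add_int n (x, y) 1 0
    simp at this
    simp [this]
  · intro x y
    have := h.iterate_add_int n (x, y) 0 1
    simp at this
    simp [this]
    ring
  · have := h.continuous_iterate n
    fun_prop

theorem exists_iterate_fst_eq (h : IsTwistPair T S) {n : ℕ} (hn : 0 < n) (x y : ℝ) :
    ∃ I, (T^[n] (x, I)).1 = y := by
  obtain ⟨C, hC⟩ := h.exists_abs_iterate_fst_sub_le n
  have hn' : (0 : ℝ) < n := by exact_mod_cast hn
  have hc : Continuous fun I => (T^[n] (x, I)).1 := by
    have := h.continuous_iterate n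
    fun_prop
  refine mem_range_of_exists_le_of_exists_ge hc ⟨(y - x - C) / n, ?_⟩ ⟨(y - x + C) / n, ?_⟩
  · have := (abs_le.1 (hC (x, (y - x - C) / n))).2
    dsimp only at this
    rw [mul_div_cancel₀ _ hn'.ne'] at this
    linarith
  · have := (abs_le.1 (hC (x, (y - x + C) / n))).1
    dsimp only at this
    rw [mul_div_cancel₀ _ hn'.ne'] at this
    linarith

end IsTwistPair

/-! ### Momenta as functions of two successive positions -/

/-- The momentum `I` for which `T (x, I)` lies over `y`. -/
def momOut (T : ℝ × ℝ → ℝ × ℝ) (x y : ℝ) : ℝ := Function.invFun (fun I => (T (x, I)).1) y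

/-- The momentum at `y` of the orbit that comes from `x`. -/
def momIn (T : ℝ × ℝ → ℝ × ℝ) (x y : ℝ) : ℝ := (T (x, momOut T x y)).2

namespace IsTwistPair

variable {T S : ℝ × ℝ → ℝ × ℝ}

theorem fst_momOut (h : IsTwistPair T S) (x y : ℝ) : (T (x, momOut T x y)).1 = y :=
  Function.invFun_eq (f := fun I => (T (x, I)).1)
    (by simpa using h.exists_iterate_fst_eq one_pos x y)

theorem apply_momOut (h : IsTwistPair T S) (x y : ℝ) : T (x, momOut T x y) = (y, momIn T x y) :=
  Prod.ext (h.fst_momOut x y) rfl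

theorem momOut_fst (h : IsTwistPair T S) (z : ℝ × ℝ) : momOut T z.1 (T z).1 = z.2 :=
  (h.mono z.1).injective (h.fst_momOut z.1 (T z).1)

theorem momIn_fst (h : IsTwistPair T S) (z : ℝ × ℝ) : momIn T z.1 (T z).1 = (T z).2 := by
  rw [momIn, h.momOut_fst]

theorem momOut_strictMono (h : IsTwistPair T S) (x : ℝ) : StrictMono (momOut T x) := by
  intro y y' hy
  rw [← (h.mono x).lt_iff_lt]
  rwa [h.fst_momOut, h.fst_momOut]

/-- This is the left twist of `S`, as `momOut_strictMono` is the right twist of `T`. Together they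
give the monotonicity on which the comparison arguments rest. -/
theorem momIn_strictAnti (h : IsTwistPair T S) (y : ℝ) : StrictAnti fun x => momIn T x y := by
  intro x x' hx
  rw [← (h.anti y).lt_iff_gt]
  dsimp only
  rw [← h.apply_momOut, ← h.apply_momOut, h.left_inv, h.left_inv]
  exact hx

theorem continuous_momOut (h : IsTwistPair T S) :
    Continuous fun z : ℝ × ℝ => momOut T z.1 z.2 := by
  have hc := h.cont
  rw [continuous_iff_continuousAt]
  intro z
  refine tendsto_order.2 ⟨fun c hc' => ?_, fun c hc' => ?_⟩
  · have h0 : (T (z.1, c)).1 < z.2 := by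
      have := h.mono z.1 hc'
      dsimp only at this
      rwa [h.fst_momOut] at this
    have ho : IsOpen {w : ℝ × ℝ | (T (w.1, c)).1 < w.2} :=
      isOpen_lt (by fun_prop) (by fun_prop)
    filter_upwards [ho.mem_nhds h0] with w hw
    rw [← (h.mono w.1).lt_iff_lt]
    rwa [h.fst_momOut]
  · have h0 : z.2 < (T (z.1, c)).1 := by
      have := h.mono z.1 hc'
      dsimp only at this
      rwa [h.fst_momOut] at this
    have ho : IsOpen {w : ℝ × ℝ | w.2 < (T (w.1, c)).1} :=
      isOpen_lt (by fun_prop) (by fun_prop)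
    filter_upwards [ho.mem_nhds h0] with w hw
    rw [← (h.mono w.1).lt_iff_lt]
    rwa [h.fst_momOut]

theorem continuous_momIn (h : IsTwistPair T S) :
    Continuous fun z : ℝ × ℝ => momIn T z.1 z.2 := by
  have h1 := h.continuous_momOut
  have h2 := h.cont
  unfold momIn
  fun_prop

theorem mom_add_int (h : IsTwistPair T S) (x y : ℝ) (m l : ℤ) :
    momOut T (x + m) (y + m + l) = momOut T x y + l ∧
      momIn T (x + m) (y + m + l) = momIn T x y + l := by
  have e := h.add_int (x, momOut T x y) m l
  rw [h.apply_momOut] at e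
  simp only [Prod.mk_add_mk] at e
  have e1 := h.momOut_fst (x + m, momOut T x y + l)
  have e2 := h.momIn_fst (x + m, momOut T x y + l)
  rw [e] at e1 e2
  simp only [← add_assoc] at e1 e2
  exact ⟨e1, e2⟩

theorem momOut_add_int (h : IsTwistPair T S) (x y : ℝ) (m : ℤ) :
    momOut T (x + m) (y + m) = momOut T x y := by
  simpa using (h.mom_add_int x y m 0).1

theorem momIn_add_int (h : IsTwistPair T S) (x y : ℝ) (m : ℤ) :
    momIn T (x + m) (y + m) = momIn T x y := by
  simpa using (h.mom_add_int x y m 0).2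

theorem isDoublyPeriodic_momOut (h : IsTwistPair T S) :
    IsDoublyPeriodic fun z => momOut T z.1 z.2 - (z.2 - z.1) := by
  constructor
  · intro x y
    have := (h.mom_add_int x y 1 (-1)).1
    simp only [Int.cast_one, Int.cast_neg, add_neg_cancel_right] at this
    dsimp only
    rw [this]
    ring
  · intro x y
    have := (h.mom_add_int x y 0 1).1
    simp only [Int.cast_one, Int.cast_zero, add_zero] at this
    dsimp only
    rw [this]
    ring

theorem isDoublyPeriodic_momIn (h : IsTwistPair T S) :
    IsDoublyPeriodic fun z => momIn T z.1 z.2 - (z.2 - z.1) := by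
  constructor
  · intro x y
    have := (h.mom_add_int x y 1 (-1)).2
    simp only [Int.cast_one, Int.cast_neg, add_neg_cancel_right] at this
    dsimp only
    rw [this]
    ring
  · intro x y
    have := (h.mom_add_int x y 0 1).2
    simp only [Int.cast_one, Int.cast_zero, add_zero] at this
    dsimp only
    rw [this]
    ring

theorem uniformContinuous_momOut (h : IsTwistPair T S) :
    UniformContinuous fun z : ℝ × ℝ => momOut T z.1 z.2 := by
  have h1 := h.continuous_momOut
  have := (h.isDoublyPeriodic_momOut.uniformContinuous (by fun_prop)).add
    (uniformContinuous_snd.sub uniformContinuous_fst)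
  simpa using this

theorem uniformContinuous_momIn (h : IsTwistPair T S) :
    UniformContinuous fun z : ℝ × ℝ => momIn T z.1 z.2 := by
  have h1 := h.continuous_momIn
  have := (h.isDoublyPeriodic_momIn.uniformContinuous (by fun_prop)).add
    (uniformContinuous_snd.sub uniformContinuous_fst)
  simpa using this

theorem exists_abs_momIn_sub_le (h : IsTwistPair T S) :
    ∃ C, ∀ x y, |momIn T x y - (y - x)| ≤ C := by
  have h1 := h.continuous_momIn
  obtain ⟨C, hC⟩ := h.isDoublyPeriodic_momIn.exists_abs_le (by fun_prop)
  exact ⟨C, fun x y => hC (x, y)⟩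

end IsTwistPair

/-! ### Solutions between sub- and supersolutions -/

/-- Perron's method for a system `F i x = 0` in which `F i x` is nondecreasing in all coordinates
of `x` except the `i`-th. -/
theorem exists_zero_between {ι : Type*} [DecidableEq ι] (F : ι → (ι → ℝ) → ℝ)
    (hcont : ∀ i x, Continuous fun t => F i (Function.update x i t))
    (hmono : ∀ i x y, x ≤ y → x i = y i → F i x ≤ F i y) {u v : ι → ℝ} (huv : u ≤ v)
    (hu : ∀ i, 0 ≤ F i u) (hv : ∀ i, F i v ≤ 0) :
    ∃ x, u ≤ x ∧ x ≤ v ∧ ∀ i, F i x = 0 := by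
  -- The solution is the coordinatewise supremum of all subsolutions below `v`.
  set P : Set (ι → ℝ) := {w | (∀ i, 0 ≤ F i w) ∧ w ≤ v} with hP
  have huP : u ∈ P := ⟨hu, huv⟩
  have hbdd : ∀ i, BddAbove ((fun w : ι → ℝ => w i) '' P) := fun i =>
    ⟨v i, by rintro _ ⟨w, hw, rfl⟩; exact hw.2 i⟩
  have hne : ∀ i, ((fun w : ι → ℝ => w i) '' P).Nonempty := fun i => ⟨_, u, huP, rfl⟩
  set x : ι → ℝ := fun i => sSup ((fun w : ι → ℝ => w i) '' P) with hx
  have hle : ∀ w ∈ P, w ≤ x := fun w hw i => le_csSup (hbdd i) ⟨w, hw, rfl⟩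
  have hxv : x ≤ v := fun i => csSup_le (hne i) (by rintro _ ⟨w, hw, rfl⟩; exact hw.2 i)
  have hsub : ∀ i, 0 ≤ F i x := by
    intro i
    by_contra! hneg
    have hnear : ∀ᶠ t in 𝓝 (x i), F i (Function.update x i t) < 0 := by
      have := (hcont i x).tendsto (x i)
      simp only [Function.update_eq_self] at this
      exact this.eventually_lt_const hneg
    obtain ⟨δ, hδ, hball⟩ := Metric.eventually_nhds_iff.1 hnear
    obtain ⟨_, ⟨w, hw, rfl⟩, hlt⟩ := exists_lt_of_lt_csSup (hne i) (sub_lt_self (x i) hδ)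
    have h1 : F i (Function.update x i (w i)) < 0 := by
      apply hball
      have := hle w hw i
      rw [Real.dist_eq, abs_lt]
      dsimp only at hlt
      constructor <;> linarith
    -- Replacing the coordinates other than `i` by those of the supremum can only raise `F i`. So
    -- continuity in the `i`-th coordinate alone suffices.
    have h2 : F i w ≤ F i (Function.update x i (w i)) := by
      refine hmono i _ _ (fun j => ?_) (by simp)
      by_cases hj : j = i
      · subst hj; simp
      · simpa [hj] using hle w hw j
    linarith [hw.1 i]
  refine ⟨x, hle u huP, hxv, fun i => le_antisymm ?_ (hsub i)⟩
  by_contra! hpos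
  have hlt : x i < v i := by
    refine lt_of_le_of_ne (hxv i) fun he => ?_
    linarith [hmono i x v hxv he, hv i]
  -- If `F i x` were positive, raising the `i`-th coordinate slightly would give a larger
  -- subsolution below `v`.
  have hnear : ∀ᶠ t in 𝓝 (x i), 0 < F i (Function.update x i t) := by
    have := (hcont i x).tendsto (x i)
    simp only [Function.update_eq_self] at this
    exact this.eventually_const_lt hpos
  obtain ⟨t, ⟨ht1, htv⟩, ht2⟩ :=
    (((hnear.and (eventually_lt_nhds hlt)).filter_mono nhdsWithin_le_nhds).and
      (self_mem_nhdsWithin (s := Set.Ioi (x i)))).exists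
  have hxw : x ≤ Function.update x i t := by
    intro j
    by_cases hj : j = i
    · subst hj; simpa using ht2.le
    · simp [hj]
  have hw : Function.update x i t ∈ P := by
    refine ⟨fun j => ?_, fun j => ?_⟩
    · by_cases hj : j = i
      · subst hj; exact ht1.le
      · exact (hsub j).trans (hmono j _ _ hxw (by simp [hj]))
    · by_cases hj : j = i
      · subst hj; simpa using htv.le
      · simpa [hj] using hxv j
  have := hle _ hw i
  simp only [Function.update_self] at this
  exact absurd ht2 (not_lt.2 this)

/-- The defect of `x 0, …, x (M + 1)` from being the sequence of positions of an orbit, together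
with a condition `f` at the index `0` and a condition `c` at the index `M + 1`. -/
def orbitDefect (T : ℝ × ℝ → ℝ × ℝ) (M : ℕ) (f : ℝ → ℝ → ℝ → ℝ) (c : ℝ → ℝ) :
    ℕ → (ℕ → ℝ) → ℝ
  | 0, x => f (x 0) (x 1) (x M)
  | j + 1, x =>
    if j < M then momOut T (x (j + 1)) (x (j + 2)) - momIn T (x j) (x (j + 1))
    else if j = M then c (x 0) - x (M + 1) else 0

namespace IsTwistPair

variable {T S : ℝ × ℝ → ℝ × ℝ}

theorem iterate_eq_of_momIn_eq (h : IsTwistPair T S) {M : ℕ} {x : ℕ → ℝ}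
    (hx : ∀ j < M, momOut T (x (j + 1)) (x (j + 2)) = momIn T (x j) (x (j + 1))) :
    ∀ i ≤ M, T^[i] (x 0, momOut T (x 0) (x 1)) = (x i, momOut T (x i) (x (i + 1))) := by
  intro i
  induction i with
  | zero => simp
  | succ i ih =>
    intro hi
    rw [Function.iterate_succ_apply', ih (by omega), h.apply_momOut, hx i (by omega)]

theorem momOut_iterate (h : IsTwistPair T S) (z : ℝ × ℝ) (i : ℕ) :
    momOut T (T^[i] z).1 (T^[i + 1] z).1 = (T^[i] z).2 := by
  rw [Function.iterate_succ_apply', h.momOut_fst]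

theorem momIn_iterate (h : IsTwistPair T S) (z : ℝ × ℝ) (i : ℕ) :
    momIn T (T^[i] z).1 (T^[i + 1] z).1 = (T^[i + 1] z).2 := by
  rw [Function.iterate_succ_apply', h.momIn_fst]

theorem momIn_iterate_eq_momOut (h : IsTwistPair T S) (z : ℝ × ℝ) (i : ℕ) :
    momIn T (T^[i] z).1 (T^[i + 1] z).1 = momOut T (T^[i + 1] z).1 (T^[i + 2] z).1 := by
  rw [h.momIn_iterate, h.momOut_iterate]

/-- The functions `f` and `c` encode boundary conditions. They are used for two fixed endpoints and
for a prescribed displacement with a prescribed gain of momentum; the latter couples `x 0` to `x M`,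
which is why `f` has three arguments. -/
theorem exists_orbit_between (h : IsTwistPair T S) (M : ℕ) {f : ℝ → ℝ → ℝ → ℝ} {c : ℝ → ℝ}
    (hf : Continuous fun p : ℝ × ℝ × ℝ => f p.1 p.2.1 p.2.2)
    (hfm : ∀ p q q' r r', q ≤ q' → r ≤ r' → f p q r ≤ f p q' r') (hc : Monotone c)
    {u v : ℕ → ℝ} (huv : ∀ i ≤ M + 1, u i ≤ v i)
    (hu0 : 0 ≤ f (u 0) (u 1) (u M)) (hv0 : f (v 0) (v 1) (v M) ≤ 0)
    (huc : u (M + 1) ≤ c (u 0)) (hvc : c (v 0) ≤ v (M + 1))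
    (hu : ∀ j < M, momIn T (u j) (u (j + 1)) ≤ momOut T (u (j + 1)) (u (j + 2)))
    (hv : ∀ j < M, momOut T (v (j + 1)) (v (j + 2)) ≤ momIn T (v j) (v (j + 1))) :
    ∃ z : ℝ × ℝ, (∀ i ≤ M + 1, u i ≤ (T^[i] z).1 ∧ (T^[i] z).1 ≤ v i) ∧
      f z.1 (T z).1 (T^[M] z).1 = 0 ∧ (T^[M + 1] z).1 = c z.1 := by
  have hupd : ∀ (x : ℕ → ℝ) (i j : ℕ), Continuous fun t => Function.update x i t j := by
    intro x i j
    have : Continuous fun t => Function.update x i t := continuous_const.update i continuous_id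
    exact continuous_pi_iff.1 this j
  have hOut : ∀ p q : ℝ → ℝ, Continuous p → Continuous q →
      Continuous fun t => momOut T (p t) (q t) := fun p q hp hq =>
    h.continuous_momOut.comp (hp.prodMk hq)
  have hIn : ∀ p q : ℝ → ℝ, Continuous p → Continuous q →
      Continuous fun t => momIn T (p t) (q t) := fun p q hp hq =>
    h.continuous_momIn.comp (hp.prodMk hq)
  -- The indices past `M + 1` carry no equation; the truncation only makes the order hold there as
  -- well.
  set tr : (ℕ → ℝ) → ℕ → ℝ := fun w i => if i ≤ M + 1 then w i else 0 with htr
  have htre : ∀ (w : ℕ → ℝ) (i : ℕ), i ≤ M + 1 → tr w i = w i := fun w i hi => by simp [htr, hi]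
  have key : ∃ x, tr u ≤ x ∧ x ≤ tr v ∧ ∀ i, orbitDefect T M f c i x = 0 := by
    refine exists_zero_between _ ?_ ?_ ?_ ?_ ?_
    · intro i y
      cases i with
      | zero =>
        have := (hupd y 0 0).prodMk ((hupd y 0 1).prodMk (hupd y 0 M))
        exact hf.comp this
      | succ j =>
        simp only [orbitDefect]
        split_ifs with h1 h2
        · exact (hOut _ _ (hupd ..) (hupd ..)).sub (hIn _ _ (hupd ..) (hupd ..))
        · have e : ∀ t, Function.update y (j + 1) t 0 = y 0 := fun t => by simp
          simp only [e]
          exact continuous_const.sub (hupd ..)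
        · exact continuous_const
    · intro i y w hyw he
      cases i with
      | zero =>
        simp only [orbitDefect, he]
        exact hfm _ _ _ _ _ (hyw 1) (hyw M)
      | succ j =>
        simp only [orbitDefect]
        split_ifs with h1 h2
        · rw [he]
          exact sub_le_sub ((h.momOut_strictMono _).monotone (hyw _))
            ((h.momIn_strictAnti _).antitone (hyw _))
        · subst h2
          rw [he]
          exact sub_le_sub_right (hc (hyw 0)) _
        · exact le_rfl
    · intro i
      simp only [htr]
      split_ifs with hi
      · exact huv i hi
      · exact le_rfl
    · intro i
      cases i with
      | zero =>
        simp only [orbitDefect, htre _ 0 (by omega), htre _ 1 (by omega), htre _ M (by omega)]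
        exact hu0
      | succ j =>
        simp only [orbitDefect]
        split_ifs with h1 h2
        · rw [htre _ _ (by omega), htre _ _ (by omega), htre _ _ (by omega)]
          exact sub_nonneg.2 (hu j h1)
        · rw [htre _ _ (by omega), htre _ _ (by omega)]
          exact sub_nonneg.2 huc
        · exact le_rfl
    · intro i
      cases i with
      | zero =>
        simp only [orbitDefect, htre _ 0 (by omega), htre _ 1 (by omega), htre _ M (by omega)]
        exact hv0
      | succ j =>
        simp only [orbitDefect]
        split_ifs with h1 h2
        · rw [htre _ _ (by omega), htre _ _ (by omega), htre _ _ (by omega)]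
          exact sub_nonpos.2 (hv j h1)
        · rw [htre _ _ (by omega), htre _ _ (by omega)]
          exact sub_nonpos.2 hvc
        · exact le_rfl
  obtain ⟨x, hux, hxv, hx⟩ := key
  have hE : ∀ j < M, momOut T (x (j + 1)) (x (j + 2)) = momIn T (x j) (x (j + 1)) := by
    intro j hj
    have := hx (j + 1)
    simp only [orbitDefect, hj, if_true] at this
    linarith
  have hit := h.iterate_eq_of_momIn_eq hE
  have hlast : (T^[M + 1] (x 0, momOut T (x 0) (x 1))).1 = x (M + 1) := by
    rw [Function.iterate_succ_apply', hit M le_rfl, h.apply_momOut]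
  have hpos : ∀ i ≤ M + 1, (T^[i] (x 0, momOut T (x 0) (x 1))).1 = x i := by
    intro i hi
    rcases Nat.lt_or_ge M i with hlt | hle
    · obtain rfl : i = M + 1 := by omega
      exact hlast
    · rw [hit i hle]
  refine ⟨(x 0, momOut T (x 0) (x 1)), fun i hi => ?_, ?_, ?_⟩
  · rw [hpos i hi]
    have h1 := hux i
    have h2 := hxv i
    rw [htre _ _ hi] at h1 h2
    exact ⟨h1, h2⟩
  · rw [h.fst_momOut, hpos M (by omega)]
    exact hx 0
  · rw [hlast]
    have := hx (M + 1)
    simp only [orbitDefect, lt_irrefl, if_true, if_false] at this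
    linarith

theorem exists_int_forall_le_add (u v : ℕ → ℝ) (n : ℕ) : ∃ m : ℤ, ∀ i ≤ n, u i ≤ v i + m := by
  induction n with
  | zero =>
    obtain ⟨m, hm⟩ := exists_int_gt (u 0 - v 0)
    exact ⟨m, fun i hi => by obtain rfl : i = 0 := by omega
                             linarith⟩
  | succ n ih =>
    obtain ⟨m, hm⟩ := ih
    obtain ⟨l, hl⟩ := exists_int_gt (u (n + 1) - v (n + 1))
    refine ⟨max m l, fun i hi => ?_⟩
    push_cast
    rcases Nat.lt_or_ge n i with hlt | hle
    · obtain rfl : i = n + 1 := by omega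
      linarith [le_max_right (m : ℝ) l]
    · linarith [hm i hle, le_max_left (m : ℝ) l]

/-- A pseudo-orbit that jumps down and climbs by at least `k`, together with an orbit that does not
climb, yields an orbit that climbs by exactly `k`. -/
theorem exists_iterate_eq_add (h : IsTwistPair T S) {M : ℕ} {s k : ℤ} (hk : 0 ≤ k)
    {w : ℝ × ℝ} (hw1 : (T^[M + 1] w).1 = w.1 + s) (hw2 : (T^[M + 1] w).2 ≤ w.2)
    {v : ℕ → ℝ} (hvs : v (M + 1) = v 0 + s)
    (hv : ∀ j < M, momOut T (v (j + 1)) (v (j + 2)) ≤ momIn T (v j) (v (j + 1)))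
    (hvk : momOut T (v 0) (v 1) + k ≤ momIn T (v M) (v (M + 1))) :
    ∃ z : ℝ × ℝ, T^[M + 1] z = z + ((s : ℝ), (k : ℝ)) := by
  obtain ⟨m, hm⟩ := exists_int_forall_le_add (fun i => (T^[i] w).1) v (M + 1)
  have hO := h.continuous_momOut
  have hI := h.continuous_momIn
  have hkr : (0 : ℝ) ≤ k := by exact_mod_cast hk
  -- The condition at index `0` says that the momentum grows by `k` along the orbit. The final
  -- position is written as `z.1 + s`, so that this condition is monotone in all positions except
  -- the first.
  have key : ∃ z : ℝ × ℝ, momOut T z.1 (T z).1 - momIn T (T^[M] z).1 (z.1 + s) + k = 0 ∧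
      (T^[M + 1] z).1 = z.1 + s := by
    refine (h.exists_orbit_between M
      (f := fun p q r => momOut T p q - momIn T r (p + s) + k) (c := fun p => p + s)
      (u := fun i => (T^[i] w).1) (v := fun i => v i + m) ?_ ?_ ?_ hm ?_ ?_ ?_ ?_ ?_ ?_).imp
      fun z hz => hz.2
    · exact ((hO.comp (continuous_fst.prodMk (continuous_fst.comp continuous_snd))).sub
        (hI.comp ((continuous_snd.comp continuous_snd).prodMk
          (continuous_fst.add continuous_const)))).add continuous_const
    · intro p q q' r r' hq hr
      have h1 := (h.momOut_strictMono p).monotone hq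
      have h2 := (h.momIn_strictAnti (p + s)).antitone hr
      linarith
    · exact fun p q hpq => by dsimp only; linarith
    · have e1 := h.momOut_iterate w 0
      have e2 := h.momIn_iterate w M
      rw [hw1] at e2
      simp only [Function.iterate_zero, id, zero_add] at e1 ⊢
      linarith
    · have e2 := h.momOut_add_int (v 0) (v 1) m
      have e3 := h.momIn_add_int (v M) (v (M + 1)) m
      rw [hvs] at e3 hvk
      have : v 0 + m + s = v 0 + s + m := by ring
      rw [e2, this, e3]
      linarith
    · exact hw1.le
    · simp only [hvs]; linarith
    · exact fun j _ => (h.momIn_iterate_eq_momOut w j).le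
    · intro j hj
      rw [h.momOut_add_int, h.momIn_add_int]
      exact hv j hj
  obtain ⟨z, hz1, hz2⟩ := key
  refine ⟨z, ?_⟩
  have e1 : momOut T z.1 (T z).1 = z.2 := h.momOut_fst z
  have e2 := h.momIn_iterate z M
  rw [hz2] at e2
  refine Prod.ext hz2 ?_
  simp only [Prod.snd_add]
  linarith

end IsTwistPair

/-! ### Drift-free maps and orbits that do not climb -/

/-- No periodic region between two horizontal lines is moved strictly into or out of itself by an
iterate of `T`. -/
def IsDriftFree (T : ℝ × ℝ → ℝ × ℝ) : Prop :=
  ∀ (N : ℕ) (V : Set (ℝ × ℝ)) (B : ℝ), MeasurableSet V → (∀ z, z + (1, 0) ∈ V ↔ z ∈ V) →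
    (∀ z : ℝ × ℝ, z.2 < -B → z ∈ V) → (∀ z ∈ V, z.2 < B) →
    (T^[N] '' V ⊆ V → interior (V \ T^[N] '' V) = ∅) ∧
      (V ⊆ T^[N] '' V → interior (T^[N] '' V \ V) = ∅)

namespace IsTwistPair

variable {T S : ℝ × ℝ → ℝ × ℝ}

/-- The maximum of two solutions is a subsolution: where one of them realises the maximum, replacing
its neighbours by larger ones lowers `momIn` and raises `momOut`. -/
theorem momIn_max_le (h : IsTwistPair T S) {a b c a' b' c' : ℝ} (hx : momIn T a b = momOut T b c)
    (hy : momIn T a' b' = momOut T b' c') :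
    momIn T (max a a') (max b b') ≤ momOut T (max b b') (max c c') := by
  rcases le_total b b' with hb | hb
  · rw [max_eq_right hb]
    calc _ ≤ momIn T a' b' := (h.momIn_strictAnti b').antitone (le_max_right _ _)
      _ = momOut T b' c' := hy
      _ ≤ _ := (h.momOut_strictMono b').monotone (le_max_right _ _)
  · rw [max_eq_left hb]
    calc _ ≤ momIn T a b := (h.momIn_strictAnti b).antitone (le_max_left _ _)
      _ = momOut T b c := hx
      _ ≤ _ := (h.momOut_strictMono b).monotone (le_max_left _ _)

/-- The highest orbit from `p` to `p + s` dominates all orbits that start and end to the left of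
it. -/
theorem iterate_fst_le_of_isTop (h : IsTwistPair T S) {M : ℕ} {s : ℤ} {p t : ℝ}
    (hK : (T^[M + 1] (p, t)).1 = p + s) (htop : ∀ J, (T^[M + 1] (p, J)).1 = p + s → J ≤ t)
    {z : ℝ × ℝ} (hz1 : z.1 ≤ p) (hz2 : (T^[M + 1] z).1 ≤ p + s) :
    ∀ i ≤ M + 1, (T^[i] z).1 ≤ (T^[i] (p, t)).1 := by
  -- The maximum of the two orbits is the subsolution, and an integer translate of the top orbit is
  -- the supersolution. The enclosed orbit from `p` to `p + s` must be the top orbit itself: its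
  -- momentum is at most `t` by maximality and at least `t` by its first step.
  obtain ⟨m, hm⟩ := exists_int_forall_le_add
    (fun i => max (T^[i] z).1 (T^[i] (p, t)).1) (fun i => (T^[i] (p, t)).1) (M + 1)
  have hm0 : (0 : ℝ) ≤ m := by
    have := (le_max_right _ _).trans (hm 0 (by omega))
    simpa using this
  have key : ∃ y : ℝ × ℝ, (∀ i ≤ M + 1, max (T^[i] z).1 (T^[i] (p, t)).1 ≤ (T^[i] y).1) ∧
      p - y.1 = 0 ∧ (T^[M + 1] y).1 = p + s := by
    refine (h.exists_orbit_between M (f := fun q _ _ => p - q) (c := fun _ => p + s)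
      (v := fun i => (T^[i] (p, t)).1 + m) ?_ ?_ ?_ hm ?_ ?_ ?_ ?_ ?_ ?_).imp
      fun y hy => ⟨fun i hi => (hy.1 i hi).1, hy.2⟩
    · fun_prop
    · exact fun _ _ _ _ _ _ _ => le_rfl
    · exact fun _ _ _ => le_rfl
    · simpa using hz1
    · simpa using hm0
    · exact max_le hz2 hK.le
    · rw [hK]
      linarith
    · exact fun j _ => h.momIn_max_le (h.momIn_iterate_eq_momOut z j)
        (h.momIn_iterate_eq_momOut (p, t) j)
    · intro j _
      rw [h.momOut_add_int, h.momIn_add_int]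
      exact (h.momIn_iterate_eq_momOut (p, t) j).ge
  obtain ⟨⟨y1, y2⟩, hy, hy1, hyN⟩ := key
  obtain rfl : y1 = p := by
    dsimp only at hy1
    linarith
  have hle : y2 ≤ t := htop _ hyN
  have hge : t ≤ y2 := by
    have := (le_max_right _ _).trans (hy 1 (by omega))
    exact (h.mono y1).le_iff_le.1 this
  obtain rfl : y2 = t := le_antisymm hle hge
  exact fun i hi => (le_max_left _ _).trans (hy i hi)

/-- Suppose that all points with displacement `s` climb. Then the region below the highest such
point on each vertical is mapped by `T^[M + 1]` onto a region that exceeds it by an open set,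
against drift-freeness. -/
theorem exists_iterate_snd_le (h : IsTwistPair T S) (hd : IsDriftFree T) (M : ℕ) (s : ℤ) :
    ∃ w : ℝ × ℝ, (T^[M + 1] w).1 = w.1 + s ∧ (T^[M + 1] w).2 ≤ w.2 := by
  by_contra! H
  have hGc := h.continuous_iterate (M + 1)
  set G := T^[M + 1] with hG
  set K : Set (ℝ × ℝ) := {z | (G z).1 = z.1 + s} with hKdef
  have hKcl : IsClosed K := isClosed_eq (by fun_prop) (by fun_prop)
  have hKper : ∀ (x I : ℝ) (m : ℤ), (x + m, I) ∈ K ↔ (x, I) ∈ K := by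
    intro x I m
    have := h.iterate_add_int (M + 1) (x, I) m 0
    simp only [Prod.mk_add_mk, Int.cast_zero, add_zero, mul_zero] at this
    simp only [hKdef, Set.mem_ofPred_eq, hG, this, Prod.fst_add]
    constructor <;> intro h <;> linarith
  obtain ⟨C, hC⟩ : ∃ C, ∀ z ∈ K, |z.2| ≤ C := by
    obtain ⟨C, hC⟩ := h.exists_abs_iterate_fst_sub_le (M + 1)
    refine ⟨C + |(s : ℝ)|, fun z hz => ?_⟩
    have h1 := hC z
    have h2 : (T^[M + 1] z).1 = z.1 + s := hz
    rw [h2, add_sub_cancel_left] at h1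
    have h3 : |((M + 1 : ℕ) : ℝ) * z.2| ≤ C + |(s : ℝ)| := by
      have := abs_sub_abs_le_abs_sub (((M + 1 : ℕ) : ℝ) * z.2) (s : ℝ)
      rw [abs_sub_comm] at this
      linarith
    refine le_trans ?_ h3
    rw [abs_mul]
    refine le_mul_of_one_le_left (abs_nonneg _) ?_
    rw [Nat.abs_cast]
    exact_mod_cast Nat.succ_le_succ (Nat.zero_le M)
  have htop : ∀ x, ∃ I, (x, I) ∈ K ∧ ∀ J, (x, J) ∈ K → J ≤ I := by
    intro x
    have hcl : IsClosed {I : ℝ | (x, I) ∈ K} := hKcl.preimage (by fun_prop)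
    have hcp : IsCompact {I : ℝ | (x, I) ∈ K} :=
      (isCompact_Icc (a := -C) (b := C)).of_isClosed_subset hcl fun I hI => abs_le.1 (hC _ hI)
    obtain ⟨I, hI⟩ := h.exists_iterate_fst_eq (Nat.succ_pos M) x (x + s)
    obtain ⟨t, ht⟩ := hcp.exists_isGreatest ⟨I, hI⟩
    exact ⟨t, ht.1, fun J hJ => ht.2 hJ⟩
  choose top htopK htopmax using htop
  have htopper : ∀ (x : ℝ) (m : ℤ), top (x + m) = top x := fun x m =>
    le_antisymm (htopmax _ _ ((hKper _ _ m).1 (htopK _))) (htopmax _ _ ((hKper _ _ m).2 (htopK _)))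
  set V : Set (ℝ × ℝ) := {z | z.2 ≤ top z.1} with hV
  have hVcl : IsClosed V := by
    refine isClosed_of_closure_subset fun z hz => ?_
    obtain ⟨y, hyV, hy⟩ := mem_closure_iff_seq_limit.1 hz
    obtain ⟨t, -, φ, hφ, ht⟩ := (isCompact_Icc (a := -C) (b := C)).tendsto_subseq
      (x := fun n => top (y n).1) fun n => abs_le.1 (hC _ (htopK _))
    have hy' := hy.comp hφ.tendsto_atTop
    have h1 : Tendsto (fun n => ((y (φ n)).1, top (y (φ n)).1)) atTop (𝓝 (z.1, t)) :=
      ((continuous_fst.tendsto z).comp hy').prodMk_nhds ht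
    have h2 : (z.1, t) ∈ K := hKcl.mem_of_tendsto h1 (.of_forall fun n => htopK _)
    have h3 : z.2 ≤ t := le_of_tendsto_of_tendsto' ((continuous_snd.tendsto z).comp hy') ht
      fun n => hyV (φ n)
    exact h3.trans (htopmax _ _ h2)
  have hmem : ∀ z' : ℝ × ℝ, z'.2 < (G (z'.1, top z'.1)).2 → z' ∈ G '' V := by
    intro z' hz'
    obtain ⟨z, rfl⟩ : ∃ z, G z = z' := ⟨_, h.iterate_right_inv (M + 1) z'⟩
    refine ⟨z, ?_, rfl⟩
    by_contra hzV
    have hzV : top z.1 < z.2 := not_le.1 hzV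
    -- A point above `top` contradicts domination by a top orbit. If its displacement is at most
    -- `s`, compare the first steps from the same vertical; otherwise compare the last steps into
    -- the same vertical.
    rcases le_total (G z).1 (z.1 + s) with hle | hle
    · have := h.iterate_fst_le_of_isTop (htopK z.1) (htopmax z.1) le_rfl hle 1 (by omega)
      exact absurd ((h.mono z.1).le_iff_le.1 this) (not_le.2 hzV)
    · set p := (G z).1 - s with hp
      have hps : p + s = (G z).1 := by rw [hp]; ring
      have := h.iterate_fst_le_of_isTop (htopK p) (htopmax p) (z := z) (by linarith) hps.ge M
        (by omega)
      have h1 := (h.momIn_strictAnti (G z).1).antitone this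
      have h2 : momIn T (T^[M] z).1 (G z).1 = (G z).2 := h.momIn_iterate z M
      have h3 : momIn T (T^[M] (p, top p)).1 (G (p, top p)).1 = (G (p, top p)).2 :=
        h.momIn_iterate _ M
      have h4 : (G (p, top p)).1 = p + s := htopK p
      rw [h4, hps] at h3
      have h5 : (G ((G z).1, top (G z).1)).2 = (G (p, top p)).2 := by
        have h6 : top (G z).1 = top p := by rw [← hps, htopper]
        have := h.iterate_add_int (M + 1) (p, top p) s 0
        simp only [Prod.mk_add_mk, Int.cast_zero, add_zero, mul_zero] at this
        rw [h6, ← hps, hG, this]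
        simp
      rw [h2, h3, ← h5] at h1
      exact absurd hz' (not_lt.2 h1)
  have hVsub : V ⊆ G '' V := fun z hz =>
    hmem z (lt_of_le_of_lt hz (H (z.1, top z.1) (htopK z.1)))
  obtain ⟨ε, hε, hεle⟩ : ∃ ε > 0, ∀ z ∈ K, z.2 + ε ≤ (G z).2 := by
    have hcp : IsCompact (K ∩ Set.Icc (0 : ℝ) 1 ×ˢ Set.Icc (-C) C) :=
      (isCompact_Icc.prod isCompact_Icc).inter_left hKcl
    have hne : (K ∩ Set.Icc (0 : ℝ) 1 ×ˢ Set.Icc (-C) C).Nonempty :=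
      ⟨(0, top 0), htopK 0, ⟨le_rfl, zero_le_one⟩, abs_le.1 (hC _ (htopK 0))⟩
    obtain ⟨q, hq, hmin⟩ := hcp.exists_isMinOn hne
      (f := fun z => (G z).2 - z.2) (by fun_prop)
    refine ⟨(G q).2 - q.2, sub_pos.2 (H q hq.1), fun ⟨x, I⟩ hz => ?_⟩
    obtain ⟨m, hm⟩ := exists_int_add_mem_Ico x
    have hz' : (x + m, I) ∈ K := (hKper x I m).2 hz
    have := hmin (a := (x + m, I)) ⟨hz', ⟨hm.1, hm.2.le⟩, abs_le.1 (hC _ hz')⟩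
    have e := h.iterate_add_int (M + 1) (x, I) m 0
    simp only [Prod.mk_add_mk, Int.cast_zero, add_zero, mul_zero] at e
    simp only [Set.mem_ofPred_eq, hG, e, Prod.snd_add, add_zero] at this
    simp only [hG]
    linarith
  have hint := (hd (M + 1) V (C + 1) hVcl.measurableSet ?_ ?_ ?_).2 hVsub
  · have hbdd : BddBelow (Set.range top) :=
      ⟨-C, by rintro _ ⟨x, rfl⟩; exact (abs_le.1 (hC _ (htopK x))).1⟩
    set m := ⨅ x, top x with hm
    obtain ⟨x₀, hx₀⟩ := exists_lt_of_ciInf_lt (show ⨅ x, top x < m + ε / 2 by linarith)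
    -- The function `top` is only upper semicontinuous. Near its infimum `m`, closedness of `V`
    -- keeps it below `m + ε / 2` on an open set, while the image of `V` reaches at least `m + ε`.
    set W : Set (ℝ × ℝ) :=
      {z | (z.1, m + ε / 2) ∉ V ∧ m + ε / 2 < z.2 ∧ z.2 < m + ε} with hW
    have hWo : IsOpen W := by
      have h1 : IsOpen {z : ℝ × ℝ | (z.1, m + ε / 2) ∉ V} :=
        hVcl.isOpen_compl.preimage (f := fun z : ℝ × ℝ => (z.1, m + ε / 2)) (by fun_prop)
      exact h1.inter ((isOpen_lt continuous_const continuous_snd).inter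
        (isOpen_lt continuous_snd continuous_const))
    have hWsub : W ⊆ G '' V \ V := by
      rintro z ⟨hz1, hz2, hz3⟩
      have hz1 : top z.1 < m + ε / 2 := not_le.1 hz1
      refine ⟨hmem z ?_, not_le.2 (hz1.trans hz2)⟩
      have := hεle _ (htopK z.1)
      have h' := ciInf_le hbdd z.1
      dsimp only at this
      linarith
    have hW0 : (x₀, m + 3 * ε / 4) ∈ W :=
      ⟨not_le.2 hx₀, by dsimp only; linarith, by dsimp only; linarith⟩
    have := interior_maximal hWsub hWo hW0
    rw [hint] at this
    exact this
  · intro z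
    have := htopper z.1 1
    simp only [Int.cast_one] at this
    simp [hV, this]
  · intro z hz
    have := (abs_le.1 (hC _ (htopK z.1))).1
    simp only [hV, Set.mem_ofPred_eq]
    dsimp only at this
    linarith
  · intro z hz
    have := (abs_le.1 (hC _ (htopK z.1))).2
    simp only [hV, Set.mem_ofPred_eq] at hz
    dsimp only at this
    linarith

end IsTwistPair

/-! ### Points reached by pseudo-orbits that jump down -/

/-- The points reached from the lower half-plane in at most `n` steps, each of which applies `T`
and then moves down. -/
def descentReach (T : ℝ × ℝ → ℝ × ℝ) : ℕ → Set (ℝ × ℝ)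
  | 0 => {z | z.2 < 0}
  | n + 1 => {z | z.2 < 0 ∨ ∃ w ∈ descentReach T n, (T w).1 = z.1 ∧ z.2 ≤ (T w).2}

namespace IsTwistPair

variable {T S : ℝ × ℝ → ℝ × ℝ}

/-- The homeomorphism of the plane given by a twist pair. -/
def toHomeomorph (h : IsTwistPair T S) : (ℝ × ℝ) ≃ₜ (ℝ × ℝ) where
  toFun := T
  invFun := S
  left_inv := h.left_inv
  right_inv := h.right_inv
  continuous_toFun := h.cont
  continuous_invFun := h.cont_inv

theorem isOpen_descentReach (h : IsTwistPair T S) (n : ℕ) : IsOpen (descentReach T n) := by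
  induction n with
  | zero => exact isOpen_lt continuous_snd continuous_const
  | succ n ih =>
    refine (isOpen_lt continuous_snd continuous_const).union ?_
    have h1 : IsOpen (T '' descentReach T n) := h.toHomeomorph.isOpenMap _ ih
    have h2 : {z : ℝ × ℝ | ∃ w ∈ descentReach T n, (T w).1 = z.1 ∧ z.2 ≤ (T w).2} =
        ⋃ t ∈ Set.Ici (0 : ℝ), (fun z : ℝ × ℝ => z + (0, t)) ⁻¹' (T '' descentReach T n) := by
      ext z
      simp only [Set.mem_ofPred_eq, Set.mem_iUnion, Set.mem_preimage, Set.mem_image, Set.mem_Ici]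
      constructor
      · rintro ⟨w, hw, e1, e2⟩
        exact ⟨(T w).2 - z.2, sub_nonneg.2 e2, w, hw, by ext <;> simp [e1]⟩
      · rintro ⟨t, ht, w, hw, e⟩
        exact ⟨w, hw, by simp [e], by simp [e, ht]⟩
    have h3 : IsOpen {z : ℝ × ℝ | ∃ w ∈ descentReach T n, (T w).1 = z.1 ∧ z.2 ≤ (T w).2} := by
      rw [h2]
      exact isOpen_biUnion fun t _ => h1.preimage (by fun_prop)
    exact h3

theorem add_int_mem_descentReach (h : IsTwistPair T S) (n : ℕ) {z : ℝ × ℝ}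
    (hz : z ∈ descentReach T n) (m : ℤ) : z + ((m : ℝ), 0) ∈ descentReach T n := by
  induction n generalizing z with
  | zero => simpa [descentReach] using hz
  | succ n ih =>
    rcases hz with hz | ⟨w, hw, e1, e2⟩
    · exact Or.inl (by simpa using hz)
    · refine Or.inr ⟨_, ih hw, ?_⟩
      rw [h.add_int_left]
      simpa using ⟨e1, e2⟩

theorem mem_descentReach_of_le (n : ℕ) {z w : ℝ × ℝ} (hz : z ∈ descentReach T n)
    (h1 : w.1 = z.1) (h2 : w.2 ≤ z.2) : w ∈ descentReach T n := by
  cases n with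
  | zero => exact lt_of_le_of_lt h2 hz
  | succ n =>
    rcases hz with hz | ⟨y, hy, e1, e2⟩
    · exact Or.inl (lt_of_le_of_lt h2 hz)
    · exact Or.inr ⟨y, hy, e1.trans h1.symm, h2.trans e2⟩

/-- The positions are recorded from the last visit to the lower half-plane on. The downward jumps
become the inequalities of a supersolution. -/
theorem exists_pseudo_orbit (h : IsTwistPair T S) {n : ℕ} {z : ℝ × ℝ}
    (hz : z ∈ descentReach T n) (hz0 : 0 ≤ z.2) :
    ∃ (M : ℕ) (v : ℕ → ℝ), v (M + 1) = z.1 ∧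
      (∀ j < M, momOut T (v (j + 1)) (v (j + 2)) ≤ momIn T (v j) (v (j + 1))) ∧
      momOut T (v 0) (v 1) < 0 ∧ z.2 ≤ momIn T (v M) (v (M + 1)) := by
  induction n generalizing z with
  | zero => exact absurd hz (not_lt.2 hz0)
  | succ n ih =>
    rcases hz with hz | ⟨w, hw, e1, e2⟩
    · exact absurd hz (not_lt.2 hz0)
    have hO := h.momOut_fst w
    have hI := h.momIn_fst w
    rw [e1] at hO hI
    rcases lt_or_ge w.2 0 with hw0 | hw0
    · exact ⟨0, fun i => if i = 0 then w.1 else z.1, by simp, by simp, by simpa [hO] using hw0,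
        by simpa [hI] using e2⟩
    · obtain ⟨M, v, hv1, hv2, hv3, hv4⟩ := ih hw hw0
      have hne : ∀ i ≤ M + 1, Function.update v (M + 2) z.1 i = v i := fun i hi =>
        Function.update_of_ne (by omega) _ _
      have hlast : Function.update v (M + 2) z.1 (M + 2) = z.1 := Function.update_self ..
      refine ⟨M + 1, Function.update v (M + 2) z.1, hlast, fun j hj => ?_, ?_, ?_⟩
      · rw [hne j (by omega), hne (j + 1) (by omega)]
        rcases Nat.lt_or_ge j M with hjM | hjM
        · rw [hne (j + 2) (by omega)]
          exact hv2 j hjM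
        · obtain rfl : j = M := by omega
          rw [hlast, hv1, hO, ← hv1]
          exact hv4
      · rwa [hne 0 (by omega), hne 1 (by omega)]
      · rw [hlast, hne _ le_rfl, hv1, hI]
        exact e2

theorem exists_iterate_eq_add_of_unbounded (h : IsTwistPair T S) (hd : IsDriftFree T) {k : ℤ}
    (hk : 0 ≤ k) (hunb : ∀ B : ℝ, ∃ n, ∃ z ∈ descentReach T n, B ≤ z.2) :
    ∃ (M : ℕ) (s : ℤ) (z : ℝ × ℝ), T^[M + 1] z = z + ((s : ℝ), (k : ℝ)) := by
  obtain ⟨C, hC⟩ := h.exists_abs_momIn_sub_le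
  have hC0 : 0 ≤ C := (abs_nonneg _).trans (hC 0 0)
  have hkr : (0 : ℝ) ≤ k := by exact_mod_cast hk
  -- The last position will be moved left by less than `1` to reach an integer displacement. This
  -- costs at most `2 * C + 1` in the final momentum, and moving left preserves the supersolution
  -- inequalities.
  obtain ⟨n, z, hz, hzB⟩ := hunb (k + 2 * C + 1)
  obtain ⟨M, v, hv1, hv2, hv3, hv4⟩ := h.exists_pseudo_orbit hz (by linarith)
  set s := ⌊v (M + 1) - v 0⌋ with hs
  have hs1 : v 0 + s ≤ v (M + 1) := by linarith [Int.floor_le (v (M + 1) - v 0)]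
  have hs2 : v (M + 1) < v 0 + s + 1 := by linarith [Int.lt_floor_add_one (v (M + 1) - v 0)]
  obtain ⟨w, hw1, hw2⟩ := h.exists_iterate_snd_le hd M s
  set v' := Function.update v (M + 1) (v 0 + s) with hv'
  have hne : ∀ i ≤ M, v' i = v i := fun i hi => Function.update_of_ne (by omega) _ _
  have hlast : v' (M + 1) = v 0 + s := Function.update_self ..
  have hle : ∀ i, v' i ≤ v i := by
    intro i
    by_cases hi : i = M + 1
    · rw [hi, hlast]
      exact hs1
    · rw [hv', Function.update_of_ne hi]
  refine ⟨M, s, h.exists_iterate_eq_add hk hw1 hw2 (v := v') ?_ ?_ ?_⟩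
  · rw [hlast, hne 0 (by omega)]
  · intro j hj
    rw [hne (j + 1) (by omega), hne j (by omega)]
    exact ((h.momOut_strictMono _).monotone (hle _)).trans (hv2 j hj)
  · rw [hne 0 (by omega), hne M le_rfl, hlast]
    have h1 := (h.momOut_strictMono (v 0)).monotone (hle 1)
    have h2 := abs_le.1 (hC (v M) (v (M + 1)))
    have h3 := abs_le.1 (hC (v M) (v 0 + s))
    linarith [h2.1, h2.2, h3.1, h3.2]

/-! ### Invariant graphs -/

theorem exists_invariant_graph (h : IsTwistPair T S) (hd : IsDriftFree T) {U : Set (ℝ × ℝ)}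
    {B : ℝ} (hUo : IsOpen U) (hdown : ∀ z ∈ U, ∀ w : ℝ × ℝ, w.1 = z.1 → w.2 ≤ z.2 → w ∈ U)
    (hper : ∀ z, z + (1, 0) ∈ U ↔ z ∈ U) (hlow : ∀ z : ℝ × ℝ, z.2 < -B → z ∈ U)
    (hup : ∀ z ∈ U, z.2 < B) (hTU : ∀ z ∈ U, T z ∈ U) :
    ∃ u : ℝ → ℝ, Continuous u ∧ (∀ x, u (x + 1) = u x) ∧
      T '' {z | z.2 = u z.1} = {z | z.2 = u z.1} := by
  set u : ℝ → ℝ := fun x => sSup {I | (x, I) ∈ U} with hu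
  have hne : ∀ x, {I | (x, I) ∈ U}.Nonempty := fun x => ⟨-B - 1, hlow _ (by dsimp only; linarith)⟩
  have hbdd : ∀ x, BddAbove {I | (x, I) ∈ U} := fun x => ⟨B, fun I hI => (hup _ hI).le⟩
  have hUu : ∀ z : ℝ × ℝ, z ∈ U ↔ z.2 < u z.1 := by
    rintro ⟨x, I⟩
    constructor
    · intro hz
      have ho : IsOpen {J | (x, J) ∈ U} := hUo.preimage (by fun_prop)
      obtain ⟨δ, hδ, hb⟩ := Metric.isOpen_iff.1 ho I hz
      have : I + δ / 2 ∈ {J | (x, J) ∈ U} := hb (by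
        rw [Metric.mem_ball, Real.dist_eq, add_sub_cancel_left, abs_of_pos (by linarith)]
        linarith)
      have := le_csSup (hbdd x) this
      dsimp only [hu]
      linarith
    · intro hz
      obtain ⟨J, hJ, hlt⟩ := exists_lt_of_lt_csSup (hne x) hz
      exact hdown _ hJ _ rfl hlt.le
  have hTU' : T '' U ⊆ U := by
    rintro _ ⟨z, hz, rfl⟩
    exact hTU z hz
  have hdense : U ⊆ closure (T '' U) := by
    have h1 := (hd 1 U B hUo.measurableSet hper hlow hup).1
    rw [Function.iterate_one] at h1
    have h2 := h1 hTU'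
    intro z hz
    by_contra hzn
    have : z ∈ interior (U \ T '' U) :=
      mem_interior.2 ⟨U ∩ (closure (T '' U))ᶜ,
        fun w hw => ⟨hw.1, fun h' => hw.2 (subset_closure h')⟩,
        hUo.inter isClosed_closure.isOpen_compl, hz, hzn⟩
    rw [h2] at this
    exact this
  have hpre : ∀ z, T z ∈ U → z ∈ closure U := by
    intro z hz
    have h1 : S (T z) ∈ closure (S '' (T '' U)) :=
      image_closure_subset_closure_image h.cont_inv ⟨_, hdense hz, rfl⟩
    rwa [h.left_inv z, h.left_inv.image_image] at h1
  -- `u` cannot jump up to the right. Take an image `T q` with `q ∈ U` near the graph over `x` and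
  -- lower `q` until its image lies over `y`; the image stays in `U` and changes height little.
  have hright : ∀ ε > 0, ∃ δ > 0, ∀ y x, y < x → x < y + δ → u x - ε ≤ u y := by
    intro ε hε
    obtain ⟨δ, hδ, hb⟩ := Metric.uniformContinuous_iff.1 h.uniformContinuous_momIn (ε / 2)
      (by linarith)
    refine ⟨δ, hδ, fun y x hyx hxy => ?_⟩
    have hI : ((x, u x - ε / 4) : ℝ × ℝ) ∈ U := (hUu _).2 (by dsimp only; linarith)
    obtain ⟨_, ⟨q, hq, rfl⟩, hdist⟩ := Metric.mem_closure_iff.1 (hdense hI)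
      (min (min (x - y) (y + δ - x)) (ε / 4)) (by
        refine lt_min (lt_min ?_ ?_) ?_ <;> linarith)
    rw [Prod.dist_eq, max_lt_iff, Real.dist_eq, Real.dist_eq] at hdist
    obtain ⟨⟨d1, d2⟩, -⟩ := (lt_min_iff.1 hdist.1).imp_left lt_min_iff.1
    have d3 := (lt_min_iff.1 hdist.2).2
    dsimp only at d1 d2 d3
    rw [abs_lt] at d1 d2 d3
    have hmem : ((y, momIn T q.1 y) : ℝ × ℝ) ∈ U := by
      rw [← h.apply_momOut]
      refine hTU _ (hdown q hq _ rfl ?_)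
      rw [← h.momOut_fst q]
      exact (h.momOut_strictMono q.1).monotone (by linarith [d1.2])
    have h1 : momIn T q.1 y < u y := (hUu _).1 hmem
    have h2 := @hb (q.1, y) (q.1, (T q).1) (by
      rw [Prod.dist_eq, dist_self, Real.dist_eq, max_lt_iff, abs_lt]
      dsimp only
      exact ⟨hδ, by linarith [d2.1], by linarith [d1.2]⟩)
    dsimp only at h2
    rw [h.momIn_fst, Real.dist_eq, abs_lt] at h2
    linarith [h2.1, d3.2]
  -- `u` cannot jump down to the right: this is the previous estimate for `S`, with the exterior of
  -- `U` in place of `U`.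
  have hleft : ∀ ε > 0, ∃ δ > 0, ∀ x x₀, x < x₀ → x₀ < x + δ → u x ≤ u x₀ + ε := by
    intro ε hε
    obtain ⟨δ₁, hδ₁, hr⟩ := hright (ε / 4) (by linarith)
    obtain ⟨δ, hδ, hb⟩ := Metric.uniformContinuous_iff.1 h.uniformContinuous_momOut (ε / 4)
      (by linarith)
    refine ⟨δ, hδ, fun x x₀ hx hx' => ?_⟩
    -- The bound `hright` controls `u` only to the right of `x₀`, so the exterior point is taken
    -- over some `x₁ > x₀`.
    obtain ⟨x₁, hx₁, hx₁'⟩ := exists_between (show x₀ < min (x₀ + δ₁) (x + δ) from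
      lt_min (by linarith) hx')
    rw [lt_min_iff] at hx₁'
    have hncl : ((x₁, u x₀ + ε / 2) : ℝ × ℝ) ∉ closure U := by
      intro hmem
      have ho : IsOpen (Set.Ioo x₀ (x₀ + δ₁) ×ˢ Set.Ioi (u x₀ + ε / 4)) :=
        isOpen_Ioo.prod isOpen_Ioi
      obtain ⟨z, ⟨⟨hz1, hz1'⟩, hz2⟩, hzU⟩ := mem_closure_iff.1 hmem _ ho
        ⟨⟨hx₁, hx₁'.1⟩, by simp only [Set.mem_Ioi]; linarith⟩
      have := hr _ _ hz1 hz1'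
      have h' := (hUu z).1 hzU
      rw [Set.mem_Ioi] at hz2
      linarith
    have hTn : T (x₁, u x₀ + ε / 2) ∉ U := fun h' => hncl (hpre _ h')
    set y := (T (x₁, u x₀ + ε / 2)).1 with hy
    have hO : momOut T x₁ y = u x₀ + ε / 2 := h.momOut_fst (x₁, u x₀ + ε / 2)
    have hI : momIn T x₁ y = (T (x₁, u x₀ + ε / 2)).2 := h.momIn_fst (x₁, u x₀ + ε / 2)
    have hn : ((x, momOut T x y) : ℝ × ℝ) ∉ U := by
      intro h'
      have h1 := hTU _ h'
      rw [h.apply_momOut] at h1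
      refine hTn (hdown _ h1 _ rfl ?_)
      rw [← hI]
      exact (h.momIn_strictAnti y).antitone (by linarith)
    have h1 : u x ≤ momOut T x y := not_lt.1 fun h' => hn ((hUu _).2 h')
    have h2 := @hb (x, y) (x₁, y) (by
      rw [Prod.dist_eq, dist_self, Real.dist_eq, max_lt_iff, abs_lt]
      dsimp only
      exact ⟨⟨by linarith [hx₁'.2], by linarith⟩, hδ⟩)
    dsimp only at h2
    rw [hO, Real.dist_eq, abs_lt] at h2
    linarith [h2.2]
  have hcont : Continuous u := by
    rw [Metric.continuous_iff]
    intro x ε hε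
    obtain ⟨δ₁, hδ₁, h1⟩ := hright (ε / 2) (by linarith)
    obtain ⟨δ₂, hδ₂, h2⟩ := hleft (ε / 2) (by linarith)
    refine ⟨min δ₁ δ₂, lt_min hδ₁ hδ₂, fun y hy => ?_⟩
    rw [Real.dist_eq, lt_min_iff, abs_lt, abs_lt] at hy
    obtain ⟨⟨a1, a2⟩, a3, a4⟩ := hy
    rw [Real.dist_eq, abs_lt]
    rcases lt_trichotomy y x with hyx | rfl | hyx
    · have := h1 y x hyx (by linarith)
      have := h2 y x hyx (by linarith)
      constructor <;> linarith
    · constructor <;> linarith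
    · have := h1 x y hyx (by linarith)
      have := h2 x y hyx (by linarith)
      constructor <;> linarith
  have hclU : closure U = {z | z.2 ≤ u z.1} := by
    refine subset_antisymm (closure_minimal (fun z hz => ((hUu z).1 hz).le)
      (isClosed_le (by fun_prop) (by fun_prop))) fun z hz => ?_
    refine Metric.mem_closure_iff.2 fun ε hε => ⟨(z.1, z.2 - ε / 2), (hUu _).2 ?_, ?_⟩
    · have hz : z.2 ≤ u z.1 := hz
      dsimp only
      linarith
    · rw [Prod.dist_eq, dist_self, Real.dist_eq, max_lt_iff, sub_sub_cancel,
        abs_of_pos (by linarith)]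
      exact ⟨hε, by linarith⟩
  -- The preimage of `U` is open and contained in `closure U`, the region on or below the graph, so
  -- it lies strictly below the graph.
  have hTUeq : T '' U = U := by
    refine subset_antisymm hTU' fun z hz => ⟨S z, ?_, h.right_inv z⟩
    have hpo : IsOpen (T ⁻¹' U) := hUo.preimage h.cont
    have hSz : S z ∈ T ⁻¹' U := by rwa [Set.mem_preimage, h.right_inv z]
    obtain ⟨δ, hδ, hb⟩ := Metric.isOpen_iff.1 hpo _ hSz
    have h1 : ((S z).1, (S z).2 + δ / 2) ∈ T ⁻¹' U := hb (by
      rw [Metric.mem_ball, Prod.dist_eq, dist_self, Real.dist_eq, max_lt_iff, add_sub_cancel_left,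
        abs_of_pos (by linarith)]
      exact ⟨hδ, by linarith⟩)
    have h2 := hpre _ h1
    rw [hclU] at h2
    have h2 : (S z).2 + δ / 2 ≤ u (S z).1 := h2
    exact (hUu _).2 (by linarith)
  refine ⟨u, hcont, fun x => ?_, ?_⟩
  · have : {I | (x + 1, I) ∈ U} = {I | (x, I) ∈ U} := by
      ext I
      have := hper (x, I)
      simpa using this
    simp only [hu, this]
  · have hgraph : {z : ℝ × ℝ | z.2 = u z.1} = closure U \ U := by
      rw [hclU]
      ext z
      simp only [Set.mem_ofPred_eq, Set.mem_sdiff, hUu, not_lt]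
      exact le_antisymm_iff
    have hcl' : T '' closure U = closure U := by
      have := h.toHomeomorph.image_closure U
      have e : (h.toHomeomorph : ℝ × ℝ → ℝ × ℝ) = T := rfl
      rwa [e, hTUeq] at this
    rw [hgraph, Set.image_sdiff h.left_inv.injective, hcl', hTUeq]

theorem exists_invariant_graph_of_bounded (h : IsTwistPair T S) (hd : IsDriftFree T) {B : ℝ}
    (hB : ∀ n, ∀ z ∈ descentReach T n, z.2 < B) :
    ∃ u : ℝ → ℝ, Continuous u ∧ (∀ x, u (x + 1) = u x) ∧
      T '' {z | z.2 = u z.1} = {z | z.2 = u z.1} := by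
  refine h.exists_invariant_graph hd (U := ⋃ n, descentReach T n) (B := max B 0)
    (isOpen_iUnion h.isOpen_descentReach) ?_ ?_ ?_ ?_ ?_
  · intro z hz w h1 h2
    obtain ⟨n, hn⟩ := Set.mem_iUnion.1 hz
    exact Set.mem_iUnion.2 ⟨n, mem_descentReach_of_le n hn h1 h2⟩
  · intro z
    simp only [Set.mem_iUnion]
    constructor
    · rintro ⟨n, hn⟩
      have := h.add_int_mem_descentReach n hn (-1)
      have e : z + (1, 0) + (((-1 : ℤ) : ℝ), 0) = z := by ext <;> simp
      exact ⟨n, e ▸ this⟩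
    · rintro ⟨n, hn⟩
      have := h.add_int_mem_descentReach n hn 1
      rw [Int.cast_one] at this
      exact ⟨n, this⟩
  · intro z hz
    exact Set.mem_iUnion.2 ⟨0, hz.trans_le (by simp)⟩
  · intro z hz
    obtain ⟨n, hn⟩ := Set.mem_iUnion.1 hz
    exact (hB n z hn).trans_le (le_max_left _ _)
  · intro z hz
    obtain ⟨n, hn⟩ := Set.mem_iUnion.1 hz
    exact Set.mem_iUnion.2 ⟨n + 1, Or.inr ⟨z, hn, rfl, le_rfl⟩⟩

theorem exists_graph_or_exists_iterate_eq_add_of_nonneg (h : IsTwistPair T S)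
    (hd : IsDriftFree T) {k : ℤ} (hk : 0 ≤ k) :
    (∃ u : ℝ → ℝ, Continuous u ∧ (∀ x, u (x + 1) = u x) ∧
      T '' {z | z.2 = u z.1} = {z | z.2 = u z.1}) ∨
    ∃ (M : ℕ) (s : ℤ) (z : ℝ × ℝ), T^[M + 1] z = z + ((s : ℝ), (k : ℝ)) := by
  by_cases hB : ∃ B : ℝ, ∀ n, ∀ z ∈ descentReach T n, z.2 < B
  · obtain ⟨B, hB⟩ := hB
    exact Or.inl (h.exists_invariant_graph_of_bounded hd hB)
  · push Not at hB
    exact Or.inr (h.exists_iterate_eq_add_of_unbounded hd hk hB)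

/-! ### Reversal of orientation in both coordinates -/

theorem neg (h : IsTwistPair T S) : IsTwistPair (fun z => -T (-z)) (fun z => -S (-z)) where
  cont := by have := h.cont; fun_prop
  cont_inv := by have := h.cont_inv; fun_prop
  left_inv z := by simp [h.left_inv (-z)]
  right_inv z := by simp [h.right_inv (-z)]
  add_left z := by
    have e := h.add_int (-z) (-1) 0
    have e' : -(z + (1, 0)) = -z + (((-1 : ℤ) : ℝ), ((0 : ℤ) : ℝ)) := by ext <;> simp; ring
    rw [e', e]
    ext <;> simp; ring
  add_right z := by
    have e := h.add_int (-z) 0 (-1)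
    have e' : -(z + (0, 1)) = -z + (((0 : ℤ) : ℝ), ((-1 : ℤ) : ℝ)) := by ext <;> simp; ring
    rw [e', e]
    ext <;> simp <;> ring
  mono x I J hIJ := by
    have := h.mono (-x) (neg_lt_neg hIJ)
    simpa using this
  anti x I J hIJ := by
    have := h.anti (-x) (neg_lt_neg hIJ)
    simpa using this

theorem neg_iterate_neg (T : ℝ × ℝ → ℝ × ℝ) (n : ℕ) (z : ℝ × ℝ) :
    (fun z => -T (-z))^[n] z = -T^[n] (-z) := by
  induction n with
  | zero => simp
  | succ n ih => rw [Function.iterate_succ_apply', ih, Function.iterate_succ_apply', neg_neg]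

/-- `-id` exchanges the two ends, so the drift of `V` under the conjugate map is that of the
complement of `-V` under `T`, with inward and outward exchanged. -/
theorem isDriftFree_neg (h : IsTwistPair T S) (hd : IsDriftFree T) :
    IsDriftFree fun z => -T (-z) := by
  intro N V B hV hper hlow hup
  have hinj : Function.Bijective T^[N] :=
    ⟨(h.iterate_left_inv N).injective, (h.iterate_right_inv N).surjective⟩
  have himg : (fun z => -T (-z))^[N] '' V = Neg.neg ⁻¹' (T^[N] '' (Neg.neg ⁻¹' V)) := by
    ext z
    simp only [Set.mem_image, Set.mem_preimage, neg_iterate_neg]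
    constructor
    · rintro ⟨w, hw, rfl⟩
      exact ⟨-w, by simpa using hw, by simp⟩
    · rintro ⟨w, hw, e⟩
      exact ⟨-w, hw, by simp [e]⟩
  have hint : ∀ A : Set (ℝ × ℝ), interior A = ∅ → interior (Neg.neg ⁻¹' A) = ∅ := by
    intro A hA
    have := (Homeomorph.neg (ℝ × ℝ)).preimage_interior A
    rw [hA] at this
    simpa using this.symm
  set V' : Set (ℝ × ℝ) := (Neg.neg ⁻¹' V)ᶜ with hV'
  have hVV' : Neg.neg ⁻¹' V = V'ᶜ := (compl_compl _).symm
  have hV'd := hd N V' (B + 1) (measurable_neg hV).compl ?_ ?_ ?_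
  · obtain ⟨h1, h2⟩ := hV'd
    rw [himg, hVV', Set.image_compl_eq hinj]
    have hV2 : V = Neg.neg ⁻¹' V'ᶜ := by
      rw [← hVV']
      ext z
      simp
    constructor
    · intro hs
      rw [hV2, ← Set.preimage_sdiff]
      refine hint _ ?_
      rw [compl_sdiff_compl]
      refine h2 fun z hz => ?_
      by_contra hz'
      have : -z ∈ V := hs (by simpa using hz')
      exact hz this
    · intro hs
      rw [hV2, ← Set.preimage_sdiff]
      refine hint _ ?_
      rw [compl_sdiff_compl]
      refine h1 fun z hz => ?_
      by_contra hz'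
      have : -z ∈ V := by simpa [hV'] using hz'
      have := hs this
      simp only [Set.mem_preimage, neg_neg] at this
      exact this hz
  · intro z
    have := hper (-(z + (1, 0)))
    have e : -(z + (1, 0)) + (1, 0) = -z := by abel
    rw [e] at this
    simp only [hV', Set.mem_compl_iff, Set.mem_preimage]
    rw [this]
  · intro z hz hzV
    have := hup _ hzV
    simp only [Prod.snd_neg] at this
    linarith
  · intro z hz
    by_contra hz'
    exact hz (hlow _ (by simp only [Prod.snd_neg]; linarith))

theorem exists_graph_or_exists_iterate_eq_add (h : IsTwistPair T S)
    (hd : IsDriftFree T) (k : ℤ) :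
    (∃ u : ℝ → ℝ, Continuous u ∧ (∀ x, u (x + 1) = u x) ∧
      T '' {z | z.2 = u z.1} = {z | z.2 = u z.1}) ∨
    ∃ (M : ℕ) (s : ℤ) (z : ℝ × ℝ), T^[M + 1] z = z + ((s : ℝ), (k : ℝ)) := by
  rcases le_total 0 k with hk | hk
  · exact h.exists_graph_or_exists_iterate_eq_add_of_nonneg hd hk
  rcases h.neg.exists_graph_or_exists_iterate_eq_add_of_nonneg (h.isDriftFree_neg hd)
    (neg_nonneg.2 hk) with ⟨u, hu, hper, hinv⟩ | ⟨M, s, z, hz⟩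
  · refine Or.inl ⟨fun x => -u (-x), by fun_prop, fun x => ?_, ?_⟩
    · have := hper (-(x + 1))
      rw [neg_add, neg_add_cancel_right] at this
      dsimp only
      rw [neg_add, this]
    · have hiff : ∀ z : ℝ × ℝ, z.2 = -u (-z.1) ↔ -z ∈ {z : ℝ × ℝ | z.2 = u z.1} := by
        intro z
        simp only [Set.mem_ofPred_eq, Prod.snd_neg, Prod.fst_neg]
        constructor <;> intro h <;> linarith
      ext z
      simp only [Set.mem_image, Set.mem_ofPred_eq]
      rw [hiff z, ← hinv]
      constructor
      · rintro ⟨w, hw, rfl⟩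
        exact ⟨-w, (hiff w).1 hw, by simp⟩
      · rintro ⟨w, hw, e⟩
        exact ⟨-w, (hiff _).2 (by simpa using hw), neg_injective e⟩
  · refine Or.inr ⟨M, -s, -z, ?_⟩
    rw [neg_iterate_neg] at hz
    rw [← neg_injective.eq_iff, hz]
    ext <;> simp <;> ring

end IsTwistPair

/-! ### Exact maps are drift-free -/

theorem cylProj_circleRep (x : Cylinder) : cylProj (circleRep x.1, x.2) = x :=
  Prod.ext (coe_circleRep x.1) rfl

theorem measurable_circleRep : Measurable circleRep :=
  measurable_subtype_coe.comp (AddCircle.measurableEquivIco (1 : ℝ) 0).measurable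

theorem isOpenMap_cylProj : IsOpenMap cylProj :=
  QuotientAddGroup.isOpenMap_coe.prodMap IsOpenMap.id

theorem exists_int_of_cylProj_eq {z w : ℝ × ℝ} (h : cylProj z = cylProj w) :
    ∃ m : ℤ, w = z + ((m : ℝ), 0) := by
  obtain ⟨m, hm⟩ := exists_int_add_eq (congrArg Prod.fst h)
  exact ⟨m, Prod.ext hm (by simpa [cylProj] using (congrArg Prod.snd h).symm)⟩

/-- `W` contains the part of the cylinder below height `-B` and lies below height `B`. -/
def IsBetween (B : ℝ) (W : Set Cylinder) : Prop :=
  (∀ x : Cylinder, x.2 < -B → x ∈ W) ∧ ∀ x ∈ W, x.2 < B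

theorem IsBetween.mono {B B' : ℝ} {W : Set Cylinder} (h : IsBetween B W) (hB : B ≤ B') :
    IsBetween B' W :=
  ⟨fun x hx => h.1 x (by linarith), fun x hx => (h.2 x hx).trans_le hB⟩

/-- The measure of the part of `W` above height `-B`. -/
def massAbove (μ : Measure Cylinder) (B : ℝ) (W : Set Cylinder) : ℝ :=
  μ.real (W \ {x | x.2 < -B})

theorem measure_image_homeomorph {μ : Measure Cylinder} {F : Cylinder ≃ₜ Cylinder}
    (hF : MeasurePreserving F μ μ) {X : Set Cylinder} (hX : MeasurableSet X) : μ (F '' X) = μ X := by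
  have hm : MeasurableSet (F '' X) := F.toMeasurableEquiv.measurableSet_image.2 hX
  have := hF.measure_preimage hm.nullMeasurableSet
  rw [F.injective.preimage_image] at this
  exact this.symm

section Flux

variable {μ : Measure Cylinder} [IsLocallyFiniteMeasure μ]

theorem measure_ne_top_of_abs_snd_le {X : Set Cylinder} {B : ℝ} (h : ∀ x ∈ X, |x.2| ≤ B) :
    μ X ≠ ⊤ := by
  have hc : IsCompact (Set.univ ×ˢ Set.Icc (-B) B : Set Cylinder) :=
    isCompact_univ.prod isCompact_Icc
  have hs : X ⊆ Set.univ ×ˢ Set.Icc (-B) B := fun x hx => ⟨trivial, abs_le.1 (h x hx)⟩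
  exact measure_ne_top_of_subset hs hc.measure_lt_top.ne

theorem IsBetween.measure_sdiff_ne_top {B : ℝ} {W W' : Set Cylinder} (h : IsBetween B W)
    (h' : IsBetween B W') : μ (W \ W') ≠ ⊤ :=
  measure_ne_top_of_abs_snd_le fun x hx =>
    abs_le.2 ⟨not_lt.1 fun hlt => hx.2 (h'.1 x hlt), (h.2 x hx.1).le⟩

theorem massAbove_sub_massAbove {B : ℝ} {W W' : Set Cylinder} (h : IsBetween B W)
    (h' : IsBetween B W') (hW : MeasurableSet W) (hW' : MeasurableSet W') :
    massAbove μ B W - massAbove μ B W' = μ.real (W \ W') - μ.real (W' \ W) := by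
  set L : Set Cylinder := {x | x.2 < -B} with hL
  have hfin : ∀ X, IsBetween B X → μ (X \ L) ≠ ⊤ := fun X hX =>
    measure_ne_top_of_abs_snd_le fun x hx => abs_le.2 ⟨not_lt.1 hx.2, (hX.2 x hx.1).le⟩
  have e1 := measureReal_inter_add_sdiff (μ := μ) (s := W \ L) hW' (hfin W h)
  have e2 := measureReal_inter_add_sdiff (μ := μ) (s := W' \ L) hW (hfin W' h')
  have s1 : (W \ L) \ W' = W \ W' := by
    ext x
    have := h'.1 x
    simp only [Set.mem_sdiff, hL, Set.mem_ofPred_eq]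
    tauto
  have s2 : (W' \ L) \ W = W' \ W := by
    ext x
    have := h.1 x
    simp only [Set.mem_sdiff, hL, Set.mem_ofPred_eq]
    tauto
  have s3 : (W \ L) ∩ W' = (W' \ L) ∩ W := by
    ext x
    simp only [Set.mem_sdiff, Set.mem_inter_iff]
    tauto
  rw [s1, s3] at e1
  rw [s2] at e2
  unfold massAbove
  linarith

variable {F : Cylinder ≃ₜ Cylinder}

/-- By invariance of `μ`, the mass difference between `W` and the lower half-cylinder equals that
between their images. Hence zero flux through one set gives zero flux through every `W`, whatever
its topology. -/
theorem massAbove_image (hF : MeasurePreserving F μ μ)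
    (hflux : μ (F '' {x | x.2 < 0} \ {x | x.2 < 0}) = μ ({x | x.2 < 0} \ F '' {x | x.2 < 0}))
    {B : ℝ} {W : Set Cylinder} (hB : 0 ≤ B) (hW : MeasurableSet W) (h1 : IsBetween B W)
    (h2 : IsBetween B (F '' W)) (h3 : IsBetween B (F '' {x | x.2 < 0})) :
    massAbove μ B (F '' W) = massAbove μ B W := by
  set A : Set Cylinder := {x | x.2 < 0} with hA
  have hAm : MeasurableSet A := measurableSet_lt measurable_snd measurable_const
  have hAB : IsBetween B A := ⟨fun x hx => hx.trans_le (by linarith), fun x hx => hx.trans_le hB⟩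
  have him : ∀ X : Set Cylinder, MeasurableSet X → MeasurableSet (F '' X) := fun X hX =>
    F.toMeasurableEquiv.measurableSet_image.2 hX
  have e1 := massAbove_sub_massAbove (μ := μ) h2 h3 (him _ hW) (him _ hAm)
  have e2 := massAbove_sub_massAbove (μ := μ) h1 hAB hW hAm
  have e3 := massAbove_sub_massAbove (μ := μ) h3 hAB (him _ hAm) hAm
  rw [← Set.image_sdiff F.injective, ← Set.image_sdiff F.injective, Measure.real, Measure.real,
    measure_image_homeomorph hF (hW.diff hAm), measure_image_homeomorph hF (hAm.diff hW)] at e1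
  rw [Measure.real, Measure.real, hflux, sub_self] at e3
  rw [Measure.real, Measure.real] at e2
  linarith

theorem IsBetween.image {B C : ℝ} {W : Set Cylinder} (h : IsBetween B W)
    (hC : ∀ x, |(F x).2 - x.2| ≤ C) : IsBetween (B + C) (F '' W) := by
  constructor
  · intro x hx
    refine ⟨F.symm x, h.1 _ ?_, F.apply_symm_apply x⟩
    have := abs_le.1 (hC (F.symm x))
    rw [F.apply_symm_apply] at this
    linarith [this.1]
  · rintro _ ⟨x, hx, rfl⟩
    have := abs_le.1 (hC x)
    linarith [this.2, h.2 x hx]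

theorem massAbove_image_iterate (hF : MeasurePreserving F μ μ)
    (hflux : μ (F '' {x | x.2 < 0} \ {x | x.2 < 0}) = μ ({x | x.2 < 0} \ F '' {x | x.2 < 0}))
    {B C : ℝ} (hB : 0 ≤ B) (hC : ∀ x, |(F x).2 - x.2| ≤ C) {W : Set Cylinder}
    (hW : MeasurableSet W) (hWB : IsBetween B W) (N : ℕ) :
    MeasurableSet (F^[N] '' W) ∧ IsBetween (B + N * C) (F^[N] '' W) ∧
      ∀ B', B + (N + 1) * C ≤ B' → massAbove μ B' (F^[N] '' W) = massAbove μ B' W := by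
  have hC0 : 0 ≤ C := (abs_nonneg _).trans (hC 0)
  induction N with
  | zero => simpa using ⟨hW, hWB⟩
  | succ N ih =>
    obtain ⟨hm, hb, hmass⟩ := ih
    have hN : (0 : ℝ) ≤ N * C := by positivity
    rw [Function.iterate_succ', Set.image_comp]
    have hb' : IsBetween (B + (N + 1 : ℕ) * C) (F '' (F^[N] '' W)) := by
      have := hb.image hC
      push_cast
      rwa [add_mul, one_mul, ← add_assoc]
    refine ⟨F.toMeasurableEquiv.measurableSet_image.2 hm, hb', fun B' hB' => ?_⟩
    push_cast at hB' hb'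
    have hA : IsBetween 0 {x : Cylinder | x.2 < 0} :=
      ⟨fun x hx => by simpa using hx, fun x hx => hx⟩
    rw [massAbove_image hF hflux (by nlinarith) hm (hb.mono (by nlinarith))
      (hb'.mono (by nlinarith)) ((hA.image hC).mono (by nlinarith))]
    exact hmass B' (by nlinarith)

end Flux

/-- The lower half of the cylinder is homeomorphic to the cylinder. -/
def lowerHalfHomeomorph : {x : Cylinder | x.2 < 0} ≃ₜ Cylinder where
  toFun x := (x.1.1, Real.log (-x.1.2))
  invFun y := ⟨(y.1, -Real.exp y.2), by simpa using Real.exp_pos y.2⟩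
  left_inv := by
    rintro ⟨⟨x, I⟩, hI : I < 0⟩
    ext <;> simp [Real.exp_log_of_neg hI]
  right_inv := by
    rintro ⟨x, I⟩
    simp
  continuous_toFun := by
    refine (continuous_fst.comp continuous_subtype_val).prodMk (Continuous.log (by fun_prop) ?_)
    rintro ⟨⟨x, I⟩, hI : I < 0⟩
    exact (neg_pos.2 hI).ne'
  continuous_invFun := by fun_prop

theorem IsMuExact.flux_lowerHalf {μ : Measure Cylinder} {F : Cylinder → Cylinder}
    (h : IsMuExact μ F) :
    μ (F '' {x | x.2 < 0} \ {x | x.2 < 0}) = μ ({x | x.2 < 0} \ F '' {x | x.2 < 0}) := by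
  refine h.flux _ (isOpen_lt continuous_snd continuous_const) ⟨lowerHalfHomeomorph⟩ ?_
  have hc : IsCompact (Set.univ ×ˢ {0} : Set Cylinder) := isCompact_univ.prod isCompact_singleton
  refine hc.of_isClosed_subset isClosed_frontier fun x hx => ⟨trivial, ?_⟩
  exact frontier_lt_subset_eq continuous_snd continuous_const hx

theorem IsTQ.exists_homeomorph {T : ℝ × ℝ → ℝ × ℝ} (hT : IsTQ T) :
    ∃ F : Cylinder ≃ₜ Cylinder, (F : Cylinder → Cylinder) = inducedCylMap T := by
  obtain ⟨F, hF⟩ := hT.lift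
  refine ⟨F, funext fun x => ?_⟩
  rw [inducedCylMap, ← hF, cylProj_circleRep]

theorem IsTQ.inducedCylMap_iterate {T : ℝ × ℝ → ℝ × ℝ} (hT : IsTQ T) (n : ℕ) (z : ℝ × ℝ) :
    (inducedCylMap T)^[n] (cylProj z) = cylProj (T^[n] z) := by
  induction n with
  | zero => rfl
  | succ n ih =>
    rw [Function.iterate_succ_apply', ih, Function.iterate_succ_apply',
      inducedCylMap_cylProj hT.toIsTwistLift]

/-- With zero net flux, a one-sided inclusion leaves a difference of measure zero, which has empty
interior since `μ` charges open sets. -/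
theorem IsMuExact.isDriftFree {T S : ℝ × ℝ → ℝ × ℝ} (hT : IsTQ T) (hTS : IsTwistPair T S)
    {μ : Measure Cylinder} [IsLocallyFiniteMeasure μ] [μ.IsOpenPosMeasure]
    (h : IsMuExact μ (inducedCylMap T)) : IsDriftFree T := by
  obtain ⟨F, hF⟩ := hT.exists_homeomorph
  have hit := hT.inducedCylMap_iterate
  have hflux := h.flux_lowerHalf
  have hinv := h.invariant
  rw [← hF] at hit hflux hinv
  obtain ⟨C, hC⟩ : ∃ C, ∀ x, |(F x).2 - x.2| ≤ C := by
    obtain ⟨C, hC⟩ := hTS.exists_abs_iterate_snd_sub_le 1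
    refine ⟨C, fun x => ?_⟩
    have := hit 1 (circleRep x.1, x.2)
    rw [cylProj_circleRep, Function.iterate_one, Function.iterate_one] at this
    rw [this]
    exact hC (circleRep x.1, x.2)
  intro N V B hV hper hlow hup
  have hperZ : ∀ (z : ℝ × ℝ) (m : ℤ), z + ((m : ℝ), 0) ∈ V ↔ z ∈ V := by
    intro z m
    have hp : Function.Periodic (fun x : ℝ => z + (x, 0) ∈ V) 1 := fun x => by
      have := hper (z + (x, 0))
      simp only [add_assoc, Prod.mk_add_mk, add_zero] at this
      exact propext this
    have e := hp.int_mul m 0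
    simp only [mul_one, zero_add, ← Prod.zero_eq_mk, add_zero] at e
    exact iff_of_eq e
  set W : Set Cylinder := {x | (circleRep x.1, x.2) ∈ V} with hWdef
  have hWm : MeasurableSet W :=
    ((measurable_circleRep.comp measurable_fst).prodMk measurable_snd) hV
  have hWV : ∀ z, cylProj z ∈ W ↔ z ∈ V := by
    intro z
    obtain ⟨m, hm⟩ := exists_int_of_cylProj_eq (cylProj_circleRep (cylProj z)).symm
    change (circleRep (cylProj z).1, (cylProj z).2) ∈ V ↔ z ∈ V
    rw [hm, hperZ]
  have himg : ∀ z, cylProj z ∈ F^[N] '' W ↔ z ∈ T^[N] '' V := by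
    intro z
    constructor
    · rintro ⟨x, hx, e⟩
      rw [← cylProj_circleRep x] at hx e
      rw [hit] at e
      obtain ⟨m, hm⟩ := exists_int_of_cylProj_eq e
      refine ⟨(circleRep x.1, x.2) + ((m : ℝ), 0), (hperZ _ _).2 ((hWV _).1 hx), ?_⟩
      have := hTS.iterate_add_int N (circleRep x.1, x.2) m 0
      simp only [Int.cast_zero, mul_zero, add_zero] at this
      rw [this, hm]
    · rintro ⟨w, hw, rfl⟩
      exact ⟨cylProj w, (hWV w).2 hw, hit N w⟩
  have hWB : IsBetween (max B 0) W :=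
    ⟨fun x hx => hlow _ (hx.trans_le (neg_le_neg (le_max_left _ _))),
      fun x hx => (hup _ hx).trans_le (le_max_left _ _)⟩
  obtain ⟨hm, hb, hmass⟩ :=
    massAbove_image_iterate hinv hflux (le_max_right B 0) hC hWm hWB N
  have hC0 : 0 ≤ C := (abs_nonneg _).trans (hC 0)
  have hN : (0 : ℝ) ≤ N * C := by positivity
  set B' := max B 0 + (N + 1) * C with hB'
  have hb1 : IsBetween B' (F^[N] '' W) := hb.mono (by nlinarith)
  have hb2 : IsBetween B' W := hWB.mono (by nlinarith)
  have hd := massAbove_sub_massAbove (μ := μ) hb1 hb2 hm hWm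
  rw [hmass B' le_rfl, sub_self] at hd
  have hempty : ∀ (X : Set (ℝ × ℝ)) (Y : Set Cylinder), (∀ z ∈ X, cylProj z ∈ Y) → μ Y = 0 →
      interior X = ∅ := by
    intro X Y hXY hY
    by_contra hne
    have ho : IsOpen (cylProj '' interior X) := isOpenMap_cylProj _ isOpen_interior
    have hpos := ho.measure_pos μ ((Set.nonempty_iff_ne_empty.2 hne).image _)
    have hle : μ (cylProj '' interior X) ≤ μ Y := measure_mono (by
      rintro _ ⟨z, hz, rfl⟩
      exact hXY z (interior_subset hz))
    rw [hY] at hle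
    exact absurd hpos (not_lt.2 hle)
  have hsub : ∀ X Y : Set Cylinder, (∀ z, cylProj z ∈ X → cylProj z ∈ Y) → X ⊆ Y :=
    fun X Y hXY x hx => by
      rw [← cylProj_circleRep x] at hx ⊢
      exact hXY _ hx
  constructor
  · intro hs
    have h0 : F^[N] '' W \ W = ∅ := Set.sdiff_eq_empty.2 (hsub _ _ fun z hz =>
      (hWV z).2 (hs ((himg z).1 hz)))
    rw [h0, measureReal_empty, zero_sub, zero_eq_neg] at hd
    refine hempty _ (W \ F^[N] '' W) (fun z hz => ⟨(hWV z).2 hz.1, fun h' =>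
      hz.2 ((himg z).1 h')⟩) ?_
    exact (measureReal_eq_zero_iff (hb2.measure_sdiff_ne_top hb1)).1 hd
  · intro hs
    have h0 : W \ F^[N] '' W = ∅ := Set.sdiff_eq_empty.2 (hsub _ _ fun z hz =>
      (himg z).2 (hs ((hWV z).1 hz)))
    rw [h0, measureReal_empty, sub_zero] at hd
    refine hempty _ (F^[N] '' W \ W) (fun z hz => ⟨(himg z).2 hz.1, fun h' =>
      hz.2 ((hWV z).1 h')⟩) ?_
    exact (measureReal_eq_zero_iff (hb1.measure_sdiff_ne_top hb2)).1 hd.symm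

/-! ### Invariant graphs are rotational invariant circles -/

theorem exists_int_forall_eq {f : ℝ → ℝ} (hf : Continuous f) (h : ∀ t, ∃ m : ℤ, f t = m) :
    ∃ m : ℤ, ∀ t, f t = m := by
  choose m hm using h
  have hm' : Continuous m :=
    Int.isClosedEmbedding_coe_real.isInducing.continuous_iff.2 (hf.congr hm)
  exact ⟨m 0, fun t => by rw [hm t, PreconnectedSpace.constant inferInstance hm' (y := 0)]⟩

/-- On a contractible circle the identity would lift to a map `f` into `ℝ`; then `f t - t` is a
constant integer, although `f` takes the same value at `0` and `1`. -/
theorem not_nullhomotopic_id_circle : ¬ (ContinuousMap.id UnitAddCircle).Nullhomotopic := by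
  intro h
  have : ContractibleSpace UnitAddCircle := (contractible_iff_id_nullhomotopic _).2 h
  have : LocallyPathConnectedSpace UnitAddCircle :=
    inferInstanceAs (LocallyPathConnectedSpace (Quotient _))
  obtain ⟨f, ⟨-, hf⟩, -⟩ := (AddCircle.isCoveringMap_coe (1 : ℝ)).existsUnique_continuousMap_lifts
    (ContinuousMap.id UnitAddCircle) ((0 : ℝ) : UnitAddCircle) 0 rfl
  have hf' : ∀ x : UnitAddCircle, ((f x : ℝ) : UnitAddCircle) = x := fun x => congrFun hf x
  obtain ⟨m, hm⟩ := exists_int_forall_eq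
    (f := fun t : ℝ => f (t : UnitAddCircle) - t)
    ((f.continuous.comp (AddCircle.continuous_mk' (1 : ℝ))).sub continuous_id) fun t => by
      obtain ⟨m, hm⟩ := exists_int_add_eq (hf' (t : UnitAddCircle)).symm
      exact ⟨m, by rw [hm]; ring⟩
  have e1 := hm 1
  have e0 := hm 0
  have : ((1 : ℝ) : UnitAddCircle) = ((0 : ℝ) : UnitAddCircle) := by simp
  rw [this] at e1
  linarith

theorem exists_isRotationalInvariantCircle_of_graph {T : ℝ × ℝ → ℝ × ℝ} (hT : IsTQ T)
    {u : ℝ → ℝ} (hu : Continuous u) (hper : ∀ x, u (x + 1) = u x)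
    (hinv : T '' {z | z.2 = u z.1} = {z | z.2 = u z.1}) :
    ∃ C : Set Cylinder, IsRotationalInvariantCircle T C := by
  have hrep : ∀ t : ℝ, u (circleRep (t : UnitAddCircle)) = u t := by
    intro t
    obtain ⟨m, hm⟩ := exists_int_add_eq (coe_circleRep (t : UnitAddCircle))
    have hp : Function.Periodic u 1 := hper
    have := hp.int_mul m (circleRep (t : UnitAddCircle))
    rw [mul_one, ← hm] at this
    exact this.symm
  have hcont : Continuous fun x : UnitAddCircle => u (circleRep x) := by
    rw [← QuotientAddGroup.isOpenQuotientMap_mk.continuous_comp_iff]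
    exact hu.congr fun t => (hrep t).symm
  let γ : C(UnitAddCircle, Cylinder) := ⟨fun x => (x, u (circleRep x)), continuous_id.prodMk hcont⟩
  have hmem : ∀ z : ℝ × ℝ, cylProj z ∈ Set.range γ ↔ z ∈ {z : ℝ × ℝ | z.2 = u z.1} := by
    intro z
    constructor
    · rintro ⟨x, hx⟩
      have h1 : x = (z.1 : UnitAddCircle) := congrArg Prod.fst hx
      have h2 : u (circleRep x) = z.2 := congrArg Prod.snd hx
      rw [h1, hrep] at h2
      exact h2.symm
    · intro hz
      exact ⟨(z.1 : UnitAddCircle), Prod.ext rfl ((hrep z.1).trans hz.symm)⟩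
  refine ⟨Set.range γ, ⟨γ, fun x y h => congrArg Prod.fst h, fun h => ?_, rfl⟩, ?_⟩
  · have e : (⟨Prod.fst, continuous_fst⟩ : C(Cylinder, UnitAddCircle)).comp γ =
        ContinuousMap.id UnitAddCircle := by
      ext x
      rfl
    exact not_nullhomotopic_id_circle (e ▸ h.comp_right _)
  · ext x
    rw [← cylProj_circleRep x, hmem, ← hinv]
    constructor
    · rintro ⟨y, hy, e⟩
      rw [← cylProj_circleRep y] at hy e
      rw [inducedCylMap_cylProj hT.toIsTwistLift] at e
      have := (hmem _).1 hy
      rw [hinv, ← hmem, ← e, hmem, ← hinv]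
      exact ⟨_, this, rfl⟩
    · rintro ⟨w, hw, e⟩
      exact ⟨cylProj w, (hmem w).2 hw, by rw [inducedCylMap_cylProj hT.toIsTwistLift, e]⟩

/-! ### Rotation vectors of orbits that climb periodically -/

theorem tendsto_periodic_sub_div {p : ℕ → ℝ} {N : ℕ} (hN : 0 < N) (hp : ∀ n, p (n + N) = p n)
    (c : ℝ) : Tendsto (fun n : ℕ => (p n - c) / n) atTop (𝓝 0) := by
  have hb : ∀ n, |p n| ≤ ∑ i ∈ Finset.range N, |p i| := by
    intro n
    have hper : Function.Periodic p N := hp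
    rw [← hper.map_mod_nat n]
    exact Finset.single_le_sum (f := fun i => |p i|) (fun i _ => abs_nonneg _)
      (Finset.mem_range.2 (Nat.mod_lt n hN))
  refine squeeze_zero_norm (a := fun n : ℕ => ((∑ i ∈ Finset.range N, |p i|) + |c|) / n)
    (fun n => ?_) (tendsto_const_div_atTop_nhds_zero_nat _)
  rw [Real.norm_eq_abs, abs_div, Nat.abs_cast]
  gcongr
  exact (abs_sub _ _).trans (by linarith [hb n])

namespace IsTwistPair

variable {T S : ℝ × ℝ → ℝ × ℝ}

theorem hasRotationVector_of_iterate_eq_add (h : IsTwistPair T S) {N : ℕ} (hN : 0 < N) {s k : ℤ}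
    (hk : k ≠ 0) {z : ℝ × ℝ} (hz : T^[N] z = z + ((s : ℝ), (k : ℝ))) :
    HasRotationVector T z (⊤, (((k : ℝ) / N : ℝ) : EReal)) ∨
      HasRotationVector T z (⊥, (((k : ℝ) / N : ℝ) : EReal)) := by
  have hN' : (N : ℝ) ≠ 0 := by exact_mod_cast hN.ne'
  have hstep : ∀ n, T^[n + N] z = T^[n] z + ((s : ℝ) + n * k, (k : ℝ)) := by
    intro n
    rw [Function.iterate_add_apply, hz, h.iterate_add_int]
  have h2 : Tendsto (fun n : ℕ => ((T^[n] z).2 - z.2) / n) atTop (𝓝 ((k : ℝ) / N)) := by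
    have := (tendsto_periodic_sub_div hN (p := fun n => (T^[n] z).2 - n * (k / N))
      (fun n => by
        rw [hstep]
        simp only [Prod.snd_add, Nat.cast_add]
        field_simp
        ring) z.2).const_add ((k : ℝ) / N)
    rw [add_zero] at this
    refine this.congr' ?_
    filter_upwards [eventually_gt_atTop 0] with n hn
    have hn' : (n : ℝ) ≠ 0 := by exact_mod_cast hn.ne'
    field_simp
    ring
  -- Over `N` steps from time `n` the abscissa gains `s + n * k`. The quadratic subtracted here has
  -- the same increments, so the remainder is `N`-periodic.
  have h1 := tendsto_periodic_sub_div hN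
    (p := fun n => (T^[n] z).1 - (k / (2 * N) * n ^ 2 + (s / N - k / 2) * n))
    (fun n => by
      rw [hstep]
      simp only [Prod.fst_add, Nat.cast_add]
      field_simp
      ring) z.1
  have h1' := h1.add_const ((s : ℝ) / N - k / 2)
  have hcongr : (fun n : ℕ => (k : ℝ) / (2 * N) * n +
      (((T^[n] z).1 - (k / (2 * N) * n ^ 2 + (s / N - k / 2) * n) - z.1) / n +
        ((s : ℝ) / N - k / 2))) =ᶠ[atTop] fun n : ℕ => ((T^[n] z).1 - z.1) / n := by
    filter_upwards [eventually_gt_atTop 0] with n hn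
    have hn' : (n : ℝ) ≠ 0 := by exact_mod_cast hn.ne'
    field_simp
    ring
  have h2' := (EReal.tendsto_coe (f := atTop)).2 h2
  rcases lt_or_gt_of_ne hk with hk | hk
  · right
    have hk' : (k : ℝ) / (2 * N) < 0 :=
      div_neg_of_neg_of_pos (by exact_mod_cast hk) (by positivity)
    have h3 := ((tendsto_natCast_atTop_atTop (R := ℝ)).const_mul_atTop_of_neg hk').atBot_add h1'
    exact (EReal.tendsto_coe_nhds_bot_iff.2 (h3.congr' hcongr)).prodMk_nhds h2'
  · left
    have hk' : 0 < (k : ℝ) / (2 * N) := div_pos (by exact_mod_cast hk) (by positivity)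
    have h3 := ((tendsto_natCast_atTop_atTop (R := ℝ)).const_mul_atTop hk').atTop_add h1'
    exact (EReal.tendsto_coe_nhds_top_iff.2 (h3.congr' hcongr)).prodMk_nhds h2'

end IsTwistPair

theorem exists_int_of_torusProj_eq {z w : ℝ × ℝ} (h : torusProj z = torusProj w) :
    ∃ m l : ℤ, w = z + ((m : ℝ), (l : ℝ)) := by
  obtain ⟨m, hm⟩ := exists_int_add_eq (congrArg Prod.fst h)
  obtain ⟨l, hl⟩ := exists_int_add_eq (congrArg Prod.snd h)
  exact ⟨m, l, Prod.ext hm hl⟩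

theorem torusProj_add_int (z : ℝ × ℝ) (m l : ℤ) :
    torusProj (z + ((m : ℝ), (l : ℝ))) = torusProj z :=
  Prod.ext
    (map_add_int_of_map_add_one (g := fun x => (x : UnitAddCircle)) (by simp) m z.1)
    (map_add_int_of_map_add_one (g := fun x => (x : UnitAddCircle)) (by simp) l z.2)

theorem IsTQ.inducedTorusMap_iterate {T : ℝ × ℝ → ℝ × ℝ} (hT : IsTQ T) (n : ℕ) (z : ℝ × ℝ) :
    (inducedTorusMap T)^[n] (torusProj z) = torusProj (T^[n] z) := by
  induction n with
  | zero => rfl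
  | succ n ih =>
    rw [Function.iterate_succ_apply', ih, Function.iterate_succ_apply',
      inducedTorusMap_torusProj hT]

theorem exists_periodicOrbit_of_iterate_eq_add {T S : ℝ × ℝ → ℝ × ℝ} (hT : IsTQ T)
    (h : IsTwistPair T S) {N : ℕ} (hN : 0 < N) {s k : ℤ} (hk : k ≠ 0) {z : ℝ × ℝ}
    (hz : T^[N] z = z + ((s : ℝ), (k : ℝ))) :
    ∃ O : Set Torus, IsPeriodicOrbit (inducedTorusMap T) O ∧
      HasVerticalRotationNumber T O ((k : ℝ) / (N : ℝ)) := by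
  refine ⟨_, ⟨torusProj z, ⟨N, hN, ?_⟩, rfl⟩, ?_⟩
  · rw [Function.IsPeriodicPt, Function.IsFixedPt, hT.inducedTorusMap_iterate, hz,
      torusProj_add_int]
  · rintro w ⟨j, hj⟩
    dsimp only at hj
    rw [hT.inducedTorusMap_iterate] at hj
    obtain ⟨m, l, rfl⟩ := exists_int_of_torusProj_eq hj
    -- Every lift of every point of the orbit climbs by the same `k`; only its horizontal
    -- displacement changes.
    refine h.hasRotationVector_of_iterate_eq_add hN (s := s + j * k + N * l) hk ?_
    rw [h.iterate_add_int, ← Function.iterate_add_apply, add_comm N j, Function.iterate_add_apply, hz,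
      h.iterate_add_int]
    push_cast
    ext <;> simp <;> ring

/-! ### Essential closed curves separate the ends of the cylinder -/

theorem lt_of_forall_mem_uIcc_ne {f : ℝ → ℝ} (hf : Continuous f) {p q c : ℝ}
    (h : ∀ x ∈ Set.uIcc p q, f x ≠ c) (hp : f p < c) : f q < c := by
  by_contra! hq
  obtain ⟨x, hx, e⟩ := intermediate_value_uIcc (hf.continuousOn (s := Set.uIcc p q))
    (Set.mem_uIcc_of_le hp.le hq)
  exact h x hx e

theorem gt_of_forall_mem_uIcc_ne {f : ℝ → ℝ} (hf : Continuous f) {p q c : ℝ}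
    (h : ∀ x ∈ Set.uIcc p q, f x ≠ c) (hp : c < f p) : c < f q := by
  have := lt_of_forall_mem_uIcc_ne (f := fun x => -f x) hf.neg (c := -c)
    (fun x hx e => h x hx (neg_injective e)) (neg_lt_neg hp)
  linarith

/-- A path from bottom to top meets a path from left to right. -/
theorem exists_eq_of_crossing {α β : ℝ → ℝ × ℝ} (hα : Continuous α) (hβ : Continuous β) {a b : ℝ}
    (hbot : ∀ t, (α 0).2 < (β t).2) (htop : ∀ t, (β t).2 < (α 1).2)
    (hl : ∀ s ∈ Set.Icc (0 : ℝ) 1, (β a).1 < (α s).1)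
    (hr : ∀ s ∈ Set.Icc (0 : ℝ) 1, (α s).1 < (β b).1) : ∃ s t, α s = β t := by
  by_contra! hne
  -- If the paths never meet, `α s - β t` is a nonvanishing function on the plane and has a
  -- continuous argument `θ`.
  let G : C(ℝ × ℝ, ℂ) := ⟨fun p => ⟨(α p.1).1 - (β p.2).1, (α p.1).2 - (β p.2).2⟩, by
    have : Continuous fun p : ℝ × ℝ =>
        Complex.equivRealProdCLM.symm ((α p.1).1 - (β p.2).1, (α p.1).2 - (β p.2).2) := by
      fun_prop
    exact this⟩
  have hG0 : ∀ p, G p ∈ ({0}ᶜ : Set ℂ) := by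
    rintro ⟨s, t⟩ h0
    have h0 : G (s, t) = 0 := h0
    refine hne s t (Prod.ext ?_ ?_)
    · exact sub_eq_zero.1 (congrArg Complex.re h0)
    · exact sub_eq_zero.1 (congrArg Complex.im h0)
  obtain ⟨L, ⟨hL0, hL⟩, -⟩ := Complex.isCoveringMapOn_exp.existsUnique_continuousMap_lifts G
    (a₀ := ((0, a) : ℝ × ℝ)) (e₀ := Complex.log (G (0, a))) (Complex.exp_log (hG0 _)) hG0
  set θ : ℝ × ℝ → ℝ := fun p => (L p).im with hθ
  have hθc : Continuous θ := Complex.continuous_im.comp L.continuous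
  have hexp : ∀ p, Complex.exp (L p) = G p := fun p => congrFun hL p
  have hre : ∀ s t, Real.exp (L (s, t)).re * Real.cos (θ (s, t)) = (α s).1 - (β t).1 := by
    intro s t
    rw [← Complex.exp_re, hexp]
    rfl
  have him : ∀ s t, Real.exp (L (s, t)).re * Real.sin (θ (s, t)) = (α s).2 - (β t).2 := by
    intro s t
    rw [← Complex.exp_im, hexp]
    rfl
  have hexp_pos : ∀ p, 0 < Real.exp (L p).re := fun p => Real.exp_pos _
  have hsin0 : ∀ t, Real.sin (θ (0, t)) < 0 := fun t =>
    neg_of_mul_neg_right (by rw [him]; linarith [hbot t]) (hexp_pos _).le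
  have hsin1 : ∀ t, 0 < Real.sin (θ (1, t)) := fun t =>
    pos_of_mul_pos_right (by rw [him]; linarith [htop t]) (hexp_pos _).le
  have hcosa : ∀ s ∈ Set.Icc (0 : ℝ) 1, 0 < Real.cos (θ (s, a)) := fun s hs =>
    pos_of_mul_pos_right (by rw [hre]; linarith [hl s hs]) (hexp_pos _).le
  have hcosb : ∀ s ∈ Set.Icc (0 : ℝ) 1, Real.cos (θ (s, b)) < 0 := fun s hs =>
    neg_of_mul_neg_right (by rw [hre]; linarith [hr s hs]) (hexp_pos _).le
  have huIcc : Set.uIcc (0 : ℝ) 1 = Set.Icc 0 1 := Set.uIcc_of_le zero_le_one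
  have h0 : (0 : ℝ) ∈ Set.Icc (0 : ℝ) 1 := ⟨le_rfl, zero_le_one⟩
  have h1 : (1 : ℝ) ∈ Set.Icc (0 : ℝ) 1 := ⟨zero_le_one, le_rfl⟩
  have hvert : ∀ s, Continuous fun t => θ (s, t) := fun s => by fun_prop
  have hhor : ∀ t, Continuous fun s => θ (s, t) := fun t => by fun_prop
  have hstart : -(Real.pi / 2) < θ (0, a) ∧ θ (0, a) < 0 := by
    have e : θ (0, a) = (G (0, a)).arg := by rw [hθ]; dsimp only; rw [hL0, Complex.log_im]
    rw [e]
    constructor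
    · refine (abs_lt.1 (Complex.abs_arg_lt_pi_div_two_iff.2 (Or.inl ?_))).1
      exact sub_pos.2 (hl 0 h0)
    · exact Complex.arg_neg_iff.2 (sub_neg.2 (hbot a))
  have hpi := Real.pi_pos
  -- The signs on the sides of the rectangle trap the argument. Via `(0, b)` one gets `θ (1, b) < -π
  -- / 2`, via `(1, a)` one gets `θ (1, b) > -π`; yet its sine is positive.
  have c1 : -Real.pi < θ (0, b) := gt_of_forall_mem_uIcc_ne (hvert 0) (p := a)
    (fun t _ e => by have := hsin0 t; rw [e] at this; simp at this) (by linarith [hstart.1])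
  have c2 : θ (0, b) < 0 := lt_of_forall_mem_uIcc_ne (hvert 0) (p := a)
    (fun t _ e => by have := hsin0 t; rw [e] at this; simp at this) hstart.2
  have c3 : θ (0, b) < -(Real.pi / 2) := by
    by_contra! hc
    exact absurd (hcosb 0 h0) (not_lt.2 (Real.cos_nonneg_of_neg_pi_div_two_le_of_le hc
      (by linarith)))
  have c4 : θ (1, b) < -(Real.pi / 2) := lt_of_forall_mem_uIcc_ne (hhor b) (p := 0)
    (fun s hs e => by
      have := hcosb s (huIcc ▸ hs)
      rw [e] at this
      simp at this) c3
  have c5 : -(Real.pi / 2) < θ (1, a) := gt_of_forall_mem_uIcc_ne (hhor a) (p := 0)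
    (fun s hs e => by
      have := hcosa s (huIcc ▸ hs)
      rw [e] at this
      simp at this) hstart.1
  have c6 : -Real.pi < θ (1, b) := gt_of_forall_mem_uIcc_ne (hvert 1) (p := a)
    (fun t _ e => by have := hsin1 t; rw [e] at this; simp at this) (by linarith)
  exact absurd (hsin1 b) (not_lt.2 (Real.sin_nonpos_of_nonpos_of_neg_pi_le (by linarith) c6.le))

/-- If the degree `d` vanished, `γ` would factor through the plane and hence be nullhomotopic. -/
theorem exists_lift_of_not_nullhomotopic {γ : C(UnitAddCircle, Cylinder)}
    (hγ : ¬ γ.Nullhomotopic) :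
    ∃ (g : ℝ → ℝ) (d : ℤ), Continuous g ∧ d ≠ 0 ∧ (∀ t, g (t + 1) = g t + d) ∧
      ∀ t : ℝ, ((g t : ℝ) : UnitAddCircle) = (γ (t : UnitAddCircle)).1 := by
  have hcoe := AddCircle.continuous_mk' (1 : ℝ)
  let f : C(ℝ, UnitAddCircle) :=
    ⟨fun t => (γ (t : UnitAddCircle)).1, continuous_fst.comp (γ.continuous.comp hcoe)⟩
  obtain ⟨g, ⟨-, hg⟩, -⟩ := (AddCircle.isCoveringMap_coe (1 : ℝ)).existsUnique_continuousMap_lifts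
    f 0 (circleRep (f 0)) (coe_circleRep _)
  have hg' : ∀ t : ℝ, ((g t : ℝ) : UnitAddCircle) = (γ (t : UnitAddCircle)).1 :=
    fun t => congrFun hg t
  obtain ⟨d, hd⟩ := exists_int_forall_eq (f := fun t => g (t + 1) - g t) (by fun_prop) fun t => by
    obtain ⟨m, hm⟩ := exists_int_add_eq (a := g t) (b := g (t + 1)) (by
      rw [hg', hg']
      simp)
    exact ⟨m, by rw [hm]; ring⟩
  refine ⟨g, d, g.continuous, ?_, fun t => by linarith [hd t], hg'⟩
  rintro rfl
  have hp : Function.Periodic g 1 := fun t => by simpa [sub_eq_zero] using hd t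
  have hrep : ∀ t : ℝ, g (circleRep (t : UnitAddCircle)) = g t := by
    intro t
    obtain ⟨m, hm⟩ := exists_int_add_eq (coe_circleRep (t : UnitAddCircle))
    have := hp.int_mul m (circleRep (t : UnitAddCircle))
    rw [mul_one, ← hm] at this
    exact this.symm
  have hcont : Continuous fun x : UnitAddCircle => g (circleRep x) := by
    rw [← QuotientAddGroup.isOpenQuotientMap_mk.continuous_comp_iff]
    exact g.continuous.congr fun t => (hrep t).symm
  let G : C(UnitAddCircle, ℝ × ℝ) := ⟨fun x => (g (circleRep x), (γ x).2),
    hcont.prodMk (continuous_snd.comp γ.continuous)⟩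
  let P : C(ℝ × ℝ, Cylinder) := ⟨cylProj, (hcoe.comp continuous_fst).prodMk continuous_snd⟩
  have e : P.comp G = γ := by
    ext x
    · change ((g (circleRep x) : ℝ) : UnitAddCircle) = (γ x).1
      rw [hg', coe_circleRep]
    · rfl
  have hG : G.Nullhomotopic := by
    have := (id_nullhomotopic (ℝ × ℝ)).comp_left G
    rwa [ContinuousMap.id_comp] at this
  exact hγ (e ▸ hG.comp_right P)

/-- Nonzero degree makes the lift of `γ` run arbitrarily far to both sides, so it crosses the lifted
path `α`. The factor `d.sign` orients it from left to right. -/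
theorem exists_cylProj_mem_range {γ : C(UnitAddCircle, Cylinder)} (hγ : ¬ γ.Nullhomotopic)
    {α : ℝ → ℝ × ℝ} (hα : Continuous α) {B : ℝ} (hB : ∀ x, |(γ x).2| < B)
    (h0 : (α 0).2 ≤ -B) (h1 : B ≤ (α 1).2) : ∃ s, cylProj (α s) ∈ Set.range γ := by
  obtain ⟨g, d, hg, hd, hstep, hgγ⟩ := exists_lift_of_not_nullhomotopic hγ
  obtain ⟨E, hE⟩ := (isCompact_Icc (a := (0 : ℝ)) (b := 1)).exists_bound_of_continuousOn
    (f := fun s => (α s).1) (by fun_prop)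
  have hZ : ∀ n : ℤ, g n = g 0 + n * d := by
    intro n
    have hp : Function.Periodic (fun t => g t - t * d) 1 := fun t => by
      dsimp only
      rw [hstep]
      ring
    have := hp.int_mul n 0
    simp only [mul_one, zero_add, zero_mul, sub_zero] at this
    linarith
  obtain ⟨n, hn⟩ := exists_nat_gt (E + |g 0|)
  have hdd : (1 : ℝ) ≤ d.sign * d := by
    rw [← Int.cast_mul, Int.sign_mul_self_eq_abs]
    exact_mod_cast Int.one_le_abs hd
  have hnd : (n : ℝ) ≤ n * (d.sign * d) := le_mul_of_one_le_right n.cast_nonneg hdd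
  have hcoe := AddCircle.continuous_mk' (1 : ℝ)
  have hgb : g ((n * d.sign : ℤ) : ℝ) = g 0 + n * (d.sign * d) := by
    rw [hZ]
    push_cast
    ring
  have hga : g ((-(n * d.sign) : ℤ) : ℝ) = g 0 - n * (d.sign * d) := by
    rw [hZ]
    push_cast
    ring
  have hg0 := abs_le.1 (le_refl |g 0|)
  obtain ⟨s, t, hst⟩ := exists_eq_of_crossing hα
    (β := fun t => (g t, (γ (t : UnitAddCircle)).2))
    (hg.prodMk (continuous_snd.comp (γ.continuous.comp hcoe)))
    (a := ((-(n * d.sign) : ℤ) : ℝ)) (b := ((n * d.sign : ℤ) : ℝ))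
    (fun t => h0.trans_lt (abs_lt.1 (hB _)).1) (fun t => (abs_lt.1 (hB _)).2.trans_le h1)
    (fun s hs => by
      have := (abs_le.1 (hE s hs)).1
      dsimp only
      rw [hga]
      linarith [hg0.2])
    (fun s hs => by
      have := (abs_le.1 (hE s hs)).2
      dsimp only at this ⊢
      rw [hgb]
      linarith [hg0.1])
  refine ⟨s, (t : UnitAddCircle), ?_⟩
  rw [hst]
  exact Prod.ext (hgγ t).symm rfl

/-! ### Rotational invariant circles bound vertical motion -/

theorem HasRotationVector.tendsto_snd {T : ℝ × ℝ → ℝ × ℝ} {z : ℝ × ℝ} {v : EReal} {ω : ℝ}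
    (h : HasRotationVector T z (v, (ω : EReal))) :
    Tendsto (fun n : ℕ => ((T^[n] z).2 - z.2) / n) atTop (𝓝 ω) :=
  EReal.tendsto_coe.1 ((continuous_snd.tendsto _).comp h)

theorem eventually_eq_mul_div (f : ℕ → ℝ) :
    (fun n : ℕ => f n / n * n) =ᶠ[atTop] f := by
  filter_upwards [eventually_gt_atTop 0] with n hn
  have hn' : (n : ℝ) ≠ 0 := by exact_mod_cast hn.ne'
  field_simp

theorem IsRotationalInvariantCircle.tendsto_snd_eq_zero {T S : ℝ × ℝ → ℝ × ℝ} (hT : IsTQ T)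
    (h : IsTwistPair T S) {C : Set Cylinder} (hC : IsRotationalInvariantCircle T C) {z : ℝ × ℝ}
    {ω : ℝ} (hz : Tendsto (fun n : ℕ => ((T^[n] z).2 - z.2) / n) atTop (𝓝 ω)) : ω = 0 := by
  obtain ⟨⟨γ, -, hγ, rfl⟩, hinv⟩ := hC
  obtain ⟨F, hF⟩ := hT.exists_homeomorph
  obtain ⟨B, hB⟩ : ∃ B, ∀ x, |(γ x).2| < B := by
    obtain ⟨B, hB⟩ := isCompact_univ.exists_bound_of_continuousOn
      (f := fun x : UnitAddCircle => (γ x).2) (by fun_prop)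
    exact ⟨B + 1, fun x => (hB x trivial).trans_lt (lt_add_one B)⟩
  have hpull : ∀ n (w : ℝ × ℝ), cylProj (T^[n] w) ∈ Set.range γ → cylProj w ∈ Set.range γ := by
    intro n w
    induction n with
    | zero => exact id
    | succ n ih =>
      intro hw
      rw [Function.iterate_succ_apply', ← inducedCylMap_cylProj hT.toIsTwistLift, ← hinv] at hw
      obtain ⟨y, hy, e⟩ := hw
      rw [← hF] at e
      exact ih (F.injective e ▸ hy)
  have hnot : ∀ w : ℝ × ℝ, B ≤ |w.2| → cylProj w ∉ Set.range γ := by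
    rintro w hw ⟨x, hx⟩
    have := hB x
    rw [hx] at this
    exact absurd this (not_lt.2 hw)
  have hshift : ∀ (l : ℤ) n, (T^[n] (z + (0, (l : ℝ)))).2 = (T^[n] z).2 + l := by
    intro l n
    have := h.iterate_add_int n z 0 l
    rw [Int.cast_zero] at this
    rw [this, Prod.snd_add]
  rcases lt_trichotomy ω 0 with hω | hω | hω
  · exfalso
    obtain ⟨l, hl⟩ := exists_int_gt (B - z.2)
    have hlim := (hz.neg_mul_atTop hω tendsto_natCast_atTop_atTop).congr'
      (eventually_eq_mul_div _)
    obtain ⟨n, hn⟩ := (hlim.eventually_le_atBot (-B - l - z.2)).exists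
    obtain ⟨D, hD⟩ := h.exists_abs_iterate_snd_sub_le n
    have hD0 : 0 ≤ D := (abs_nonneg _).trans (hD 0)
    have hTn := h.continuous_iterate n
    have hhigh : ∀ s : ℝ, B ≤ (z + (0, (l : ℝ)) + (0, |s| * D)).2 := fun s => by
      have : 0 ≤ |s| * D := by positivity
      simp only [Prod.snd_add]
      linarith
    -- The path is the image of a vertical ray above the strip `|I| < B`. The crossing parameter `s`
    -- may be any real number, so `|s|` keeps the ray above the strip for all `s`; `D` bounds the
    -- vertical motion under `T^[n]` and keeps the image of the far end high.
    obtain ⟨s, hs⟩ := exists_cylProj_mem_range hγ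
      (α := fun s => T^[n] (z + (0, (l : ℝ)) + (0, |s| * D))) (by fun_prop) hB
      (by
        simp only [abs_zero, zero_mul, ← Prod.zero_eq_mk, add_zero]
        rw [hshift]
        linarith)
      (by
        have := (abs_le.1 (hD (z + (0, (l : ℝ)) + (0, |(1 : ℝ)| * D)))).1
        have h2 : (z + (0, (l : ℝ)) + (0, |(1 : ℝ)| * D)).2 = z.2 + l + D := by simp
        rw [h2] at this
        linarith)
    exact hnot _ ((hhigh s).trans (le_abs_self _)) (hpull _ _ hs)
  · exact hω
  · exfalso
    obtain ⟨l, hl⟩ := exists_int_lt (-B - z.2)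
    have hlim := (hz.pos_mul_atTop hω tendsto_natCast_atTop_atTop).congr'
      (eventually_eq_mul_div _)
    obtain ⟨n, hn⟩ := (hlim.eventually_ge_atTop (B - l - z.2)).exists
    obtain ⟨D, hD⟩ := h.exists_abs_iterate_snd_sub_le n
    have hD0 : 0 ≤ D := (abs_nonneg _).trans (hD 0)
    have hTn := h.continuous_iterate n
    have hlow : ∀ s : ℝ, (z + (0, (l : ℝ)) + (0, -(|1 - s| * D))).2 ≤ -B := fun s => by
      have : 0 ≤ |1 - s| * D := by positivity
      simp only [Prod.snd_add]
      linarith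
    obtain ⟨s, hs⟩ := exists_cylProj_mem_range hγ
      (α := fun s => T^[n] (z + (0, (l : ℝ)) + (0, -(|1 - s| * D)))) (by fun_prop) hB
      (by
        have := (abs_le.1 (hD (z + (0, (l : ℝ)) + (0, -(|1 - (0 : ℝ)| * D))))).2
        have h2 : (z + (0, (l : ℝ)) + (0, -(|1 - (0 : ℝ)| * D))).2 = z.2 + l - D := by
          simp
          ring
        rw [h2] at this
        linarith)
      (by
        simp only [sub_self, abs_zero, zero_mul, neg_zero, ← Prod.zero_eq_mk, add_zero]
        rw [hshift]
        linarith)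
    exact hnot _ (le_abs.2 (Or.inr (by linarith [hlow s]))) (hpull _ _ hs)

end

theorem mainTheorem1 (T : ℝ × ℝ → ℝ × ℝ) (hT : IsTQ T)
    (μ : Measure Cylinder) [IsLocallyFiniteMeasure μ] [μ.IsOpenPosMeasure]
    (hac : μ ≪ (volume : Measure Cylinder))
    (hexact : IsMuExact μ (inducedCylMap T)) :
    ∀ k : ℤ, k ≠ 0 →
      ((∃ N : ℕ, 0 < N ∧ ∃ O : Set Torus, IsPeriodicOrbit (inducedTorusMap T) O ∧
          HasVerticalRotationNumber T O ((k : ℝ) / (N : ℝ))) ↔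
        ¬ ∃ C : Set Cylinder, IsRotationalInvariantCircle T C) := by
  obtain ⟨S, hTS⟩ := hT.exists_isTwistPair
  intro k hk
  constructor
  · rintro ⟨N, hN, O, ⟨x, -, rfl⟩, hrot⟩ ⟨C, hC⟩
    have hlift : torusProj (circleRep x.1, circleRep x.2) = x :=
      Prod.ext (coe_circleRep _) (coe_circleRep _)
    have h0 : ((k : ℝ) / N) ≠ 0 :=
      div_ne_zero (by exact_mod_cast hk) (by exact_mod_cast hN.ne')
    rcases hrot _ ⟨0, hlift.symm⟩ with h | h
    · exact h0 (hC.tendsto_snd_eq_zero hT hTS h.tendsto_snd)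
    · exact h0 (hC.tendsto_snd_eq_zero hT hTS h.tendsto_snd)
  · intro hno
    rcases hTS.exists_graph_or_exists_iterate_eq_add (hexact.isDriftFree hT hTS) k with
      ⟨u, hu, hper, hinv⟩ | ⟨M, s, z, hz⟩
    · exact absurd (exists_isRotationalInvariantCircle_of_graph hT hu hper hinv) hno
    · exact ⟨M + 1, M.succ_pos, exists_periodicOrbit_of_iterate_eq_add hT hTS M.succ_pos hk hz⟩
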